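/- **Setting.** Let $T\ge T_0$ ($T_0\ge 1$) denote the sample size and $p=p_T$ the number of regressors. For each $T$ let $x_t=(x_{t1},\dots,x_{tp})^\top$, $t\ge 1$, be regressors (allowed to depend on $T$, and possibly random; working conditionally on the regressors is the case of non-random $x_t$), and let $\mathbb X_T=(x_1,\dots,x_T)^\top$. For fixed $\nu$ and an arbitrary $\beta_\nu\in\mathbb R^{p}$ let $Y_t^{(\nu)}=x_t^\top\beta_\nu+\epsilon_t^{(\nu)}$, and let $\hat\beta_{T\nu}=(\mathbb X_T^\top\mathbb X_T)^{-1}\mathbb X_T^\top (Y^{(\nu)}_1,\dots,Y^{(\nu)}_T)^\top$ be the least squares estimator. **Assumption (R).** Almost surely, the regressors are bounded by a constant, and there are positive definite $p\times p$ matrices $\Sigma_x$, constants $\eta\ge 0$, $C<\infty$ and a compact interval $A\subset(0,\infty)$ such that for all $T\ge T_0$ $$\Big\|\tfrac1T\sum_{t=1}^T x_tx_t^\top-\Sigma_x\Big\|_2\le C\,\frac{p^\eta}{\sqrt T},\qquad \operatorname{spec}(T^{-1}\mathbb X_T^\top\mathbb X_T)\subset A .$$ **Assumption (G), growth of sum moment,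 with constants $\gamma'\ge2$, $C_\nu$.** For all $2\le\gamma\le\gamma'$ and all $N\in\mathbb N$, $\ \sup_j \mathbb E\big|\sum_{t=1}^N x_{tj}\epsilon_t^{(\nu)}\big|^\gamma\le C_\nu N^{\gamma/2}$. **Rate condition.** $p\le T$ for $T\ge T_0$ and $p=o(T)$ if $0\le\eta\le 1/2$; $p^{2\eta}=o(T)$ if $\eta>1/2$. **Theorem.** Suppose (R) holds. (i) If the rate condition holds and $\gamma'\ge 2$, there are constants $K,C'>0$, depending only on the design and $\gamma'$, such that for all errors $\epsilon^{(\nu)}$ that satisfy (G) with $\gamma'$ and $C_\nu$, all $2\le\gamma\le\gamma'$, all $\delta>0$ and all $T\ge T_0$ $$\mathbb P(\|\hat\beta_{T\nu}-\beta_\nu\|_2>\delta)\le K C_\nu\Big(\sqrt{p/T}\Big)^{\gamma}\delta^{-\gamma},$$ in particular $\hat\beta_{T\nu}=\beta_\nu+O_{\mathbb P}(\sqrt{p/T})$, and $$\mathbb E\|\hat\beta_{T\nu}-\beta_\nu\|_2^2\le\Big(C'\frac{p^\eta}{\sqrt T}+\lambda_{\min}^{-1}\Big)^2 C_\nu\,\frac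 pT ,$$ where $\lambda_{\min}=\inf_{T\ge T_0}\inf\operatorname{spec}(T^{-1}\mathbb X_T^\top\mathbb X_T)$ (essential infimum for random regressors), and this upper bound is $o(1)$ as $T\to\infty$. (ii) Let the errors follow the spatial factor/linear-process model $$\epsilon_t^{(\nu)}=H_\nu(U_t,\dots,U_{t-m})-\mathbb E H_\nu(U_t,\dots,U_{t-m}),\quad U_t^{(\nu)}(s)=\sum_{\ell=1}^L\phi_{\nu\ell}\,d(s,r_\ell)F_t^{(\ell,\nu)}+F_t^{(0,\nu)},\quad F_t^{(\ell)}=\sum_{j\ge0}\mathbb C_j^{(\ell)}\varepsilon_{t-j}^{(\ell)},$$ $1\le\nu\le d$, the $U$'s being evaluated at locations in $[0,1]^q$ along the path of the object, where $r_1,\dots,r_L\in[0,1]^q$, $d(u,v)\in[0,1]$ is a nonincreasing function of $\|u-v\|$ (for some norm) with $d(u,u)=1$, and for $\ell=0,\dots,L$, $t\in\mathbb Z$: (a) the innovations $\varepsilon_t^{(\ell)}=(\Sigma_t^{(\ell)})^{1/2}u_t^{(\ell)}$ are independent over $(\ell,t)$, with symmetric positive definite $\Sigma_t^{(\ell)}$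 and mean zero $u_t^{(\ell)}$ with independent coordinates; (b) their coordinates have uniformly bounded fourth moments; (c) $\lambda_{\min}(\Sigma_t^{(0)})$ (for $d=1$: the variance of $\varepsilon^{(0)}_t$) is bounded away from $0$ uniformly in $t$; (d) the coordinates have densities $p_t^{(\ell,\nu)}$ with $\sup_{t\ge1}\int|p_t^{(\ell,\nu)}(z+x)-p_t^{(\ell,\nu)}(z)|\,dz=O(|x|)$; (e) the entries of $\mathbb C_j^{(\ell)}$ are bounded by $\mathrm{const}\cdot\max(j,1)^{-5-\delta'}$ for some $\delta'>0$; (f) the $H_\nu:\mathbb R^{d\times(m+1)}\to\mathbb R$ are Lipschitz continuous in the Frobenius norm, and $\mathbb E|H_\nu(\Xi)|^4<\infty$ for some random matrix $\Xi$ independent of $\{U_t\}$. If the regressors are non-random, or random and independent of the innovations, then (G) holds with $\gamma'=2$ and some $C_\nu$; hence, under the rate condition, the assertions of (i) hold with $\gamma'=2$. (iii) Let the regressors be the output $x_t=x_t^{(r)}$ of the last hidden layer of an extreme learning machine with $r\ge1$ hidden layers ($r=1$: single hidden layer), $$x_{tj}^{(k)}=g_k\big(b_{jk}+w_j^{(k)\top}x_t^{(k-1)}\big),\quad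 1\le j\le n_k,\ 1\le k\le r,\qquad x_t^{(0)}=z_t,\quad n_r=p,$$ with measurable activations, where the random weights and biases together with the (random or fixed) inputs $z_t$ are independent of the innovations; activations may differ between neurons and widths may depend on $T$. If the errors are as in (ii), then (G) holds with $\gamma'=2$ and some $C_\nu$, and hence, under the rate condition, the assertions of (i) hold with $\gamma'=2$, both with respect to the joint probability and, almost surely and with the same constants, conditionally on the weights and inputs. -/

import Mathlib

open MeasureTheory ProbabilityTheory Filter Topology

noncomputable section

/-! ## Regressors and least squares

The regressors form an array `X T t j`: `T` is the sample size, `t ≥ 1` the time point and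
`j < p T` the coordinate of the regressor vector. They are random variables on the same space as the
errors; working conditionally on `X_t = x_t` means that `X` does not depend on `ω`. -/

/-- The `T × p` design matrix, whose rows are the regressor vectors at times `1, …, T`. -/
def designMatrix {Ω : Type*} (p : ℕ → ℕ) (X : ℕ → ℕ → ℕ → Ω → ℝ) (T : ℕ) (ω : Ω) :
    Matrix (Fin T) (Fin (p T)) ℝ :=
  Matrix.of fun t j => X T (t + 1) j ω

/-- The Gram matrix `T⁻¹ 𝕏ᵀ 𝕏 = T⁻¹ ∑ₜ xₜ xₜᵀ`. -/
def gramMatrix {Ω : Type*} (p : ℕ → ℕ) (X : ℕ → ℕ → ℕ → Ω → ℝ) (T : ℕ) (ω : Ω) :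
    Matrix (Fin (p T)) (Fin (p T)) ℝ :=
  (T : ℝ)⁻¹ • ((designMatrix p X T ω).transpose * designMatrix p X T ω)

/-- The responses `Y_t = x_tᵀ β + e_t`, `t = 1, …, T`. -/
def response {Ω : Type*} (p : ℕ → ℕ) (X : ℕ → ℕ → ℕ → Ω → ℝ) (e : ℕ → Ω → ℝ)
    (β : ∀ T, Fin (p T) → ℝ) (T : ℕ) (ω : Ω) : Fin T → ℝ :=
  fun t => (designMatrix p X T ω).mulVec (β T) t + e (t + 1) ω

/-- The least squares estimator `(𝕏ᵀ 𝕏)⁻¹ 𝕏ᵀ Y`. -/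
def leastSquares {Ω : Type*} (p : ℕ → ℕ) (X : ℕ → ℕ → ℕ → Ω → ℝ) (e : ℕ → Ω → ℝ)
    (β : ∀ T, Fin (p T) → ℝ) (T : ℕ) (ω : Ω) : Fin (p T) → ℝ :=
  (((designMatrix p X T ω).transpose * designMatrix p X T ω)⁻¹ *
    (designMatrix p X T ω).transpose).mulVec (response p X e β T ω)

/-- The Euclidean norm of the estimation error of least squares. -/
def estError {Ω : Type*} (p : ℕ → ℕ) (X : ℕ → ℕ → ℕ → Ω → ℝ) (e : ℕ → Ω → ℝ)
    (β : ∀ T, Fin (p T) → ℝ) (T : ℕ) (ω : Ω) : ℝ :=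
  ‖WithLp.toLp 2 (leastSquares p X e β T ω - β T)‖

/-- The regressors are bounded by `B`, and for all `T ≥ T₀` the Gram matrix is within
`C p^η / √T` of the positive definite matrix `Sx T` in spectral norm and has its spectrum in the
compact interval `[a, b] ⊂ (0, ∞)`, almost surely. -/
structure RegressorAssumption {Ω : Type*} [MeasurableSpace Ω] (μ : Measure Ω) (T₀ : ℕ)
    (p : ℕ → ℕ) (X : ℕ → ℕ → ℕ → Ω → ℝ) (Sx : ∀ T, Matrix (Fin (p T)) (Fin (p T)) ℝ)
    (B η C a b : ℝ) : Prop where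
  bounded : ∀ T ≥ T₀, ∀ t ≥ 1, ∀ j < p T, ∀ᵐ ω ∂μ, |X T t j ω| ≤ B
  posDef : ∀ T ≥ T₀, (Sx T).PosDef
  eta_nonneg : 0 ≤ η
  a_pos : 0 < a
  a_le_b : a ≤ b
  rate : ∀ T ≥ T₀, ∀ᵐ ω ∂μ,
    ‖Matrix.toEuclideanCLM (𝕜 := ℝ) (gramMatrix p X T ω - Sx T)‖ ≤ C * (p T : ℝ) ^ η / √(T : ℝ)
  spec : ∀ T ≥ T₀, ∀ᵐ ω ∂μ, spectrum ℝ (gramMatrix p X T ω) ⊆ Set.Icc a b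

/-- `T ≥ p` and `p = o(T)` if `η ≤ 1/2`; `p^{2η} = o(T)` if `η > 1/2`. -/
def RateCondition (T₀ : ℕ) (p : ℕ → ℕ) (η : ℝ) : Prop :=
  (η ≤ 1 / 2 → (∀ T ≥ T₀, p T ≤ T) ∧ Tendsto (fun T => (p T : ℝ) / T) atTop (𝓝 0)) ∧
  (1 / 2 < η → Tendsto (fun T => (p T : ℝ) ^ (2 * η) / T) atTop (𝓝 0))

/-- The growth of sum moment assumption
`sup_j E |∑_{t=1}^N x_{tj} e_t|^γ ≤ Cν N^{γ/2}` for all `N` and all `2 ≤ γ ≤ γ'`. -/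
def GrowthOfSumMoment {Ω : Type*} [MeasurableSpace Ω] (μ : Measure Ω) (T₀ : ℕ)
    (p : ℕ → ℕ) (X : ℕ → ℕ → ℕ → Ω → ℝ) (e : ℕ → Ω → ℝ) (γ' Cν : ℝ) : Prop :=
  ∀ γ : ℝ, 2 ≤ γ → γ ≤ γ' → ∀ T ≥ T₀, ∀ N : ℕ, ∀ j < p T,
    Integrable (fun ω => |∑ t ∈ Finset.Icc 1 N, X T t j ω * e t ω| ^ γ) μ ∧
    ∫ ω, |∑ t ∈ Finset.Icc 1 N, X T t j ω * e t ω| ^ γ ∂μ ≤ Cν * (N : ℝ) ^ (γ / 2)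

/-- The infimum of the spectra of all Gram matrices. It is the plain infimum for a non-random design,
and its essential infimum over `ω` for a random one. -/
def lamMin {Ω : Type*} [MeasurableSpace Ω] (μ : Measure Ω) (T₀ : ℕ) (p : ℕ → ℕ)
    (X : ℕ → ℕ → ℕ → Ω → ℝ) : ℝ :=
  essInf (fun ω => sInf {l : ℝ | ∃ T ≥ T₀, l ∈ spectrum ℝ (gramMatrix p X T ω)}) μ

/-- The mean square error bound `(C' p^η / √T + 1 / λ_min)² Cν p / T`. -/
def meanSquareBound {Ω : Type*} [MeasurableSpace Ω] (μ : Measure Ω) (T₀ : ℕ) (p : ℕ → ℕ)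
    (X : ℕ → ℕ → ℕ → Ω → ℝ) (η Cν C' : ℝ) (T : ℕ) : ℝ :=
  (C' * (p T : ℝ) ^ η / √(T : ℝ) + (lamMin μ T₀ p X)⁻¹) ^ 2 * Cν * ((p T : ℝ) / T)

/-- The consistency assertions for least squares, for every true parameter `β`: the tail bound, the
rate `O_P(√(p/T))`, and the mean square bound together with its convergence to `0`. -/
structure ConsistencyAssertions {Ω : Type*} [MeasurableSpace Ω] (μ : Measure Ω) (T₀ : ℕ)
    (p : ℕ → ℕ) (X : ℕ → ℕ → ℕ → Ω → ℝ) (η : ℝ) (e : ℕ → Ω → ℝ) (γ' Cν K C' : ℝ) : Prop where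
  tail : ∀ β : (∀ T, Fin (p T) → ℝ), ∀ γ : ℝ, 2 ≤ γ → γ ≤ γ' → ∀ δ > (0 : ℝ), ∀ T ≥ T₀,
    μ.real {ω | δ < estError p X e β T ω} ≤ K * Cν * √((p T : ℝ) / T) ^ γ * δ ^ (-γ)
  bigOP : ∀ β : (∀ T, Fin (p T) → ℝ), ∀ ε > (0 : ℝ), ∃ M > (0 : ℝ), ∀ T ≥ T₀,
    μ.real {ω | M * √((p T : ℝ) / T) < estError p X e β T ω} ≤ ε
  meanSquare : ∀ β : (∀ T, Fin (p T) → ℝ), ∀ T ≥ T₀,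
    Integrable (fun ω => estError p X e β T ω ^ 2) μ ∧
    ∫ ω, estError p X e β T ω ^ 2 ∂μ ≤ meanSquareBound μ T₀ p X η Cν C' T
  bound_tendsto : Tendsto (meanSquareBound μ T₀ p X η Cν C') atTop (𝓝 0)

/-! ## The spatial factor / linear process error model -/

/-- The spatial domain `[0, 1]` in `ℝ^q`. -/
abbrev Site (q : ℕ) : Type := Set.Icc (0 : Fin q → ℝ) 1

/-- The data of the error model. The index `0` of `Fin (L + 1)` belongs to the idiosyncratic noise,
the index `ℓ + 1` to the `ℓ`-th factor. `site t k` is the location at which the lagged variable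
`U_{t-k}` is evaluated in the error at time `t`; both `site t k = s_t` and
`site t k = s_{t-k}` are allowed. -/
structure ErrorModel (Ω : Type*) (d q m L : ℕ) where
  u : Fin (L + 1) → ℤ → Ω → Fin d → ℝ
  Sig : Fin (L + 1) → ℤ → Matrix (Fin d) (Fin d) ℝ
  SigRoot : Fin (L + 1) → ℤ → Matrix (Fin d) (Fin d) ℝ
  coef : Fin (L + 1) → ℕ → Matrix (Fin d) (Fin d) ℝ
  load : Fin d → Fin L → ℝ
  prox : Site q → Site q → ℝ
  loc : Fin L → Site q
  H : Matrix (Fin d) (Fin (m + 1)) ℝ → Fin d → ℝ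
  site : ℕ → Fin (m + 1) → Site q

namespace ErrorModel

variable {Ω : Type*} {d q m L : ℕ} (M : ErrorModel Ω d q m L)

/-- The innovations `ε_t^{(ℓ)} = (Σ_t^{(ℓ)})^{1/2} u_t^{(ℓ)}`. -/
def innov (ℓ : Fin (L + 1)) (t : ℤ) (ω : Ω) : Fin d → ℝ :=
  (M.SigRoot ℓ t).mulVec (M.u ℓ t ω)

/-- The linear processes `∑_{j ≥ 0} C_j^{(ℓ)} ε_{t-j}^{(ℓ)}`. -/
def linProc (ℓ : Fin (L + 1)) (t : ℤ) (ω : Ω) : Fin d → ℝ :=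
  ∑' j : ℕ, (M.coef ℓ j).mulVec (M.innov ℓ (t - j) ω)

/-- `U_t^{(ν)}(s) = ∑_ℓ φ_{νℓ} d(s, r_ℓ) F_t^{(ℓ,ν)} + E_t^{(ν)}`. -/
def U (t : ℤ) (s : Site q) (ω : Ω) (ν : Fin d) : ℝ :=
  ∑ ℓ : Fin L, M.load ν ℓ * M.prox s (M.loc ℓ) * M.linProc ℓ.succ t ω ν + M.linProc 0 t ω ν

/-- The `d × (m+1)` matrix `(U_t, …, U_{t-m})`. -/
def window (t : ℕ) (ω : Ω) : Matrix (Fin d) (Fin (m + 1)) ℝ :=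
  Matrix.of fun ν k => M.U ((t : ℤ) - ((k : ℕ) : ℤ)) (M.site t k) ω ν

/-- The errors `ε_t^{(ν)} = H_ν(U_t, …, U_{t-m}) - E H_ν(U_t, …, U_{t-m})`. -/
def err [MeasurableSpace Ω] (μ : Measure Ω) (ν : Fin d) (t : ℕ) (ω : Ω) : ℝ :=
  M.H (M.window t ω) ν - ∫ ω', M.H (M.window t ω') ν ∂μ

/-- The assumptions on the errors, with fourth moments of the innovations and coefficients of
order `j^{-5-δ'}`. -/
structure Assumptions [MeasurableSpace Ω] (μ : Measure Ω) : Prop where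
  /-- The weight `d(u, v)` is a nonincreasing function of `‖u - v‖` for some norm, with
  values in `[0, 1]` and value `1` on the diagonal. -/
  prox_antitone : ∃ nrm : Seminorm ℝ (Fin q → ℝ), (∀ x, nrm x = 0 → x = 0) ∧
    ∀ u v u' v' : Site q, nrm ((u : Fin q → ℝ) - v) ≤ nrm ((u' : Fin q → ℝ) - v') →
      M.prox u' v' ≤ M.prox u v
  prox_mem : ∀ u v, M.prox u v ∈ Set.Icc (0 : ℝ) 1
  prox_self : ∀ u, M.prox u u = 1
  /-- `SigRoot` is the positive definite square root of the positive definite matrix `Sig`. -/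
  sig_posDef : ∀ ℓ t, (M.Sig ℓ t).PosDef
  sigRoot_posDef : ∀ ℓ t, (M.SigRoot ℓ t).PosDef
  sigRoot_sq : ∀ ℓ t, M.SigRoot ℓ t * M.SigRoot ℓ t = M.Sig ℓ t
  u_measurable : ∀ ℓ t, Measurable (M.u ℓ t)
  u_mean : ∀ ℓ t ν, ∫ ω, M.u ℓ t ω ν ∂μ = 0
  u_coord_indep : ∀ ℓ t, iIndepFun (fun (ν : Fin d) ω => M.u ℓ t ω ν) μ
  /-- Independent sequences of independent innovation vectors. -/
  innov_indep : iIndepFun (fun (i : Fin (L + 1) × ℤ) ω => M.innov i.1 i.2 ω) μ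
  /-- Uniformly bounded fourth moments. -/
  innov_moment : ∃ K : ℝ, ∀ ℓ t ν, Integrable (fun ω => |M.innov ℓ t ω ν| ^ 4) μ ∧
    ∫ ω, |M.innov ℓ t ω ν| ^ 4 ∂μ ≤ K
  /-- Bounded variances, and idiosyncratic variances bounded away from zero, if `d = 1`. -/
  var_le : d = 1 → ∃ K : ℝ, ∀ ℓ t ν, ∫ ω, M.innov ℓ t ω ν ^ 2 ∂μ ≤ K
  le_var : d = 1 → ∃ s > (0 : ℝ), ∀ t ν, s ≤ ∫ ω, M.innov 0 t ω ν ^ 2 ∂μ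
  /-- Smallest eigenvalue of the idiosyncratic matrices bounded away from zero, if `d > 1`. -/
  le_eigen : 1 < d → ∃ l > (0 : ℝ), ∀ t, spectrum ℝ (M.Sig 0 t) ⊆ Set.Ici l
  /-- The coordinates of the innovations have densities that are `L₁`-Lipschitz under shifts. -/
  density : ∀ ℓ ν, ∃ f : ℤ → ℝ → ℝ,
    (∀ t, Measurable (f t) ∧ (∀ z, 0 ≤ f t z) ∧
      μ.map (fun ω => M.innov ℓ t ω ν) = volume.withDensity (fun z => ENNReal.ofReal (f t z))) ∧
    ∃ K : ℝ, ∀ t ≥ 1, ∀ x : ℝ, ∫ z, |f t (z + x) - f t z| ≤ K * |x|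
  /-- Algebraic decay of the coefficients. -/
  decay : ∃ K : ℝ, ∃ δ' > (0 : ℝ), ∀ ℓ (j : ℕ) ν k,
    |M.coef ℓ j ν k| ≤ K * ((max j 1 : ℕ) : ℝ) ^ (-5 - δ')
  /-- `H_ν` is Lipschitz with respect to the Frobenius norm. -/
  lipschitz : ∃ LH : ℝ, ∀ ν x y, |M.H x ν - M.H y ν| ≤ LH * √(∑ i, ∑ k, (x i k - y i k) ^ 2)
  /-- There is a random matrix, independent of the `U_t`, at which `H` has fourth moments. -/
  exists_xi : ∃ Ξ : Ω → Fin d → Fin (m + 1) → ℝ, Measurable Ξ ∧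
    IndepFun Ξ (fun ω (i : ℤ × Site q) => M.U i.1 i.2 ω) μ ∧
    ∀ ν, Integrable (fun ω => |M.H (Matrix.of (Ξ ω)) ν| ^ 4) μ

end ErrorModel

/-! ## Networks with random weights -/

/-- The output of the `j`-th neuron of layer `k` of a feedforward network with input `z`, layer
widths `n`, weights `W k j i`, biases `b k j` and activation functions `g k j`:
`x_j^{(k)} = g_k (b_{jk} + ∑_{i < n_{k-1}} w_{ji}^{(k)} x_i^{(k-1)})`, with `x^{(0)} = z`. The activation
may depend on the neuron, so that a constant neuron (an intercept) is allowed. A single hidden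
layer net is the case `k = 1`. -/
def netOutput (g : ℕ → ℕ → ℝ → ℝ) (n : ℕ → ℕ) (W : ℕ → ℕ → ℕ → ℝ) (b : ℕ → ℕ → ℝ)
    (z : ℕ → ℝ) : ℕ → ℕ → ℝ
  | 0, i => z i
  | k + 1, j => g (k + 1) j
      (b (k + 1) j + ∑ i ∈ Finset.range (n k), W (k + 1) j i * netOutput g n W b z k i)

end

/-!
By the normal equations the estimation error is the inverse Gram matrix applied to the vector
`T⁻¹ ∑ t, x_t ε_t`. A lower bound on the spectrum of the Gram matrix thus reduces everything to the
moments of the `p` scores `∑ t, x_{tj} ε_t`, which the growth of sum moment assumption controls: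
Markov's inequality yields the tail bound, and the second moment the mean square bound.

In the error model, truncating the linear processes at lag `t - s - m` removes from the error at time
`t` all innovations up to time `s`, so the autocovariance at times `s ≤ t` is bounded by the `L²`
truncation error. These errors are summable because `∑ j, j ‖C_j‖ < ∞`, and absolutely summable
autocovariances let the second moment of `∑_{t ≤ N} x_{tj} ε_t` grow at most linearly in `N` when
the regressors are bounded and independent of the innovations.
-/

section LinearAlgebra

open scoped ComplexOrder in
theorem mul_norm_toLp_le_norm_toLp_mulVec {𝕜 n : Type*} [RCLike 𝕜] [Fintype n] [DecidableEq n]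
    {A : Matrix n n 𝕜} (hA : A.IsHermitian) {l : ℝ} (hl : spectrum ℝ A ⊆ Set.Ici l) (v : n → 𝕜) :
    l * ‖WithLp.toLp 2 v‖ ≤ ‖WithLp.toLp 2 (A.mulVec v)‖ := by
  have hsub : (A - algebraMap ℝ _ l).IsHermitian :=
    hA.sub (IsSelfAdjoint.algebraMap _ (.all l))
  have hpos : (A - algebraMap ℝ _ l).PosSemidef :=
    hsub.posSemidef_iff_eigenvalues_nonneg.2 fun i => by
      have hi := hsub.eigenvalues_mem_spectrum_real i
      rw [← spectrum.sub_singleton_eq] at hi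
      obtain ⟨x, hx, _, rfl, hxi⟩ := hi
      exact hxi ▸ sub_nonneg.2 (hl hx)
  have hinner : l * ‖WithLp.toLp 2 v‖ ^ 2 ≤
      RCLike.re (inner 𝕜 (WithLp.toLp 2 v) (WithLp.toLp 2 (A.mulVec v))) := by
    have h := hpos.re_dotProduct_nonneg v
    rw [Algebra.algebraMap_eq_smul_one, Matrix.sub_mulVec, Matrix.smul_mulVec, Matrix.one_mulVec,
      dotProduct_sub, dotProduct_smul, map_sub, RCLike.smul_re, sub_nonneg] at h
    rwa [← inner_self_eq_norm_sq (𝕜 := 𝕜), EuclideanSpace.inner_toLp_toLp,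
      EuclideanSpace.inner_toLp_toLp, dotProduct_comm v, dotProduct_comm (A.mulVec v)]
  rcases (norm_nonneg (WithLp.toLp 2 v)).eq_or_lt with hv | hv
  · simp only [← hv, mul_zero, norm_nonneg]
  · refine le_of_mul_le_mul_left ?_ hv
    calc ‖WithLp.toLp 2 v‖ * (l * ‖WithLp.toLp 2 v‖) = l * ‖WithLp.toLp 2 v‖ ^ 2 := by ring
      _ ≤ ‖WithLp.toLp 2 v‖ * ‖WithLp.toLp 2 (A.mulVec v)‖ :=
        hinner.trans ((RCLike.re_le_norm _).trans (norm_inner_le_norm _ _))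

variable {α R n : Type*} [MeasurableSpace α] [MeasurableSpace R] [Fintype n] [DecidableEq n]

theorem measurable_matrix_det [CommRing R] [MeasurableAdd₂ R] [MeasurableMul₂ R]
    {A : α → Matrix n n R} (hA : ∀ i j, Measurable fun x => A x i j) :
    Measurable fun x => (A x).det := by
  simp only [Matrix.det_apply']
  exact Finset.measurable_sum _ fun σ _ =>
    (Finset.measurable_prod _ fun i _ => hA _ _).const_mul _

theorem measurable_matrix_inv_apply [Field R] [MeasurableAdd₂ R] [MeasurableMul₂ R]
    [MeasurableInv R] {A : α → Matrix n n R} (hA : ∀ i j, Measurable fun x => A x i j) (i j : n) :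
    Measurable fun x => (A x)⁻¹ i j := by
  simp only [Matrix.inv_def, Matrix.smul_apply, Ring.inverse_eq_inv', smul_eq_mul,
    Matrix.adjugate_apply]
  refine (measurable_matrix_det hA).inv.mul (measurable_matrix_det fun k l => ?_)
  simp only [Matrix.updateRow_apply]
  split_ifs
  · exact measurable_const
  · exact hA k l

end LinearAlgebra

section LeastSquares

variable {Ω : Type*} {p : ℕ → ℕ} {X : ℕ → ℕ → ℕ → Ω → ℝ} (e : ℕ → Ω → ℝ)
  (β : ∀ T, Fin (p T) → ℝ)

theorem gramMatrix_isHermitian (T : ℕ) (ω : Ω) : (gramMatrix p X T ω).IsHermitian := by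
  have h := Matrix.isHermitian_conjTranspose_mul_self (designMatrix p X T ω)
  rw [Matrix.conjTranspose_eq_transpose_of_trivial] at h
  rw [Matrix.IsHermitian, gramMatrix, Matrix.conjTranspose_smul, h.eq, star_trivial]

theorem designMatrix_transpose_mulVec_apply (T : ℕ) (ω : Ω) (j : Fin (p T)) :
    (designMatrix p X T ω).transpose.mulVec (fun t : Fin T => e (t + 1) ω) j =
      ∑ t ∈ Finset.Icc 1 T, X T t j ω * e t ω := by
  simp only [Matrix.mulVec, dotProduct, Matrix.transpose_apply, designMatrix, Matrix.of_apply]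
  rw [Fin.sum_univ_eq_sum_range (fun t => X T (t + 1) j ω * e (t + 1) ω) T,
    Finset.range_eq_Ico, Finset.sum_Ico_add' (fun t => X T t j ω * e t ω) 0 T 1]
  rfl

theorem gramMatrix_mulVec_leastSquares_sub {T : ℕ} {ω : Ω}
    (h0 : (0 : ℝ) ∉ spectrum ℝ (gramMatrix p X T ω)) :
    (gramMatrix p X T ω).mulVec (leastSquares p X e β T ω - β T) =
      (T : ℝ)⁻¹ • fun j : Fin (p T) => ∑ t ∈ Finset.Icc 1 T, X T t j ω * e t ω := by
  set D := designMatrix p X T ω with hD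
  rcases eq_or_ne T 0 with rfl | hT
  · simp [gramMatrix]
  have hdet : IsUnit (D.transpose * D).det := by
    rw [spectrum.zero_notMem_iff, Matrix.isUnit_iff_isUnit_det, gramMatrix, Matrix.det_smul] at h0
    exact isUnit_of_mul_isUnit_right h0
  have hresponse : response p X e β T ω = D.mulVec (β T) + fun t : Fin T => e (t + 1) ω := rfl
  have hnormal : (D.transpose * D).mulVec (leastSquares p X e β T ω) =
      D.transpose.mulVec (response p X e β T ω) := by
    rw [leastSquares, ← hD, Matrix.mulVec_mulVec, ← Matrix.mul_assoc,
      Matrix.mul_nonsing_inv _ hdet, Matrix.one_mul]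
  rw [gramMatrix, ← hD, Matrix.smul_mulVec, Matrix.mulVec_sub, hnormal, hresponse,
    Matrix.mulVec_add, Matrix.mulVec_mulVec, add_sub_cancel_left]
  congr 1
  ext j
  exact designMatrix_transpose_mulVec_apply e T ω j

theorem estError_nonneg (T : ℕ) (ω : Ω) : 0 ≤ estError p X e β T ω := norm_nonneg _

theorem estError_eq_zero_of_eq_zero {T : ℕ} (hp : p T = 0) (ω : Ω) :
    estError p X e β T ω = 0 := by
  have : IsEmpty (Fin (p T)) := hp ▸ Fin.isEmpty
  rw [estError, EuclideanSpace.norm_eq, Finset.univ_eq_empty, Finset.sum_empty, Real.sqrt_zero]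

theorem estError_le {T : ℕ} {ω : Ω} {l : ℝ} (hl : 0 < l)
    (hspec : spectrum ℝ (gramMatrix p X T ω) ⊆ Set.Ici l) :
    estError p X e β T ω ≤ l⁻¹ * ((T : ℝ)⁻¹ *
      √(∑ j : Fin (p T), |∑ t ∈ Finset.Icc 1 T, X T t j ω * e t ω| ^ 2)) := by
  have h := mul_norm_toLp_le_norm_toLp_mulVec (gramMatrix_isHermitian T ω) hspec
    (leastSquares p X e β T ω - β T)
  rw [gramMatrix_mulVec_leastSquares_sub e β fun h => hl.not_ge (hspec h), WithLp.toLp_smul,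
    norm_smul, norm_inv, Real.norm_natCast] at h
  refine (le_inv_mul_iff₀ hl).2 (h.trans_eq ?_)
  simp only [EuclideanSpace.norm_eq, Real.norm_eq_abs]

theorem estError_rpow_le {T : ℕ} {ω : Ω} {l γ : ℝ} (hl : 0 < l)
    (hspec : spectrum ℝ (gramMatrix p X T ω) ⊆ Set.Ici l) (hγ : 2 ≤ γ) :
    estError p X e β T ω ^ γ ≤ l⁻¹ ^ γ * ((T : ℝ)⁻¹ ^ γ * ((p T : ℝ) ^ (γ / 2 - 1) *
      ∑ j : Fin (p T), |∑ t ∈ Finset.Icc 1 T, X T t j ω * e t ω| ^ γ)) := by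
  set S : Fin (p T) → ℝ := fun j => |∑ t ∈ Finset.Icc 1 T, X T t j ω * e t ω| with hS
  have hsq (x : ℝ) (hx : 0 ≤ x) : (x ^ 2) ^ (γ / 2) = x ^ γ := by
    rw [← Real.rpow_two, ← Real.rpow_mul hx, mul_div_cancel₀ γ two_ne_zero]
  have hmean : √(∑ j, S j ^ 2) ^ γ ≤ (p T : ℝ) ^ (γ / 2 - 1) * ∑ j, S j ^ γ :=
    calc √(∑ j, S j ^ 2) ^ γ = (∑ j, S j ^ 2) ^ (γ / 2) := by
          rw [← hsq _ (Real.sqrt_nonneg _), Real.sq_sqrt (by positivity)]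
      _ ≤ (p T : ℝ) ^ (γ / 2 - 1) * ∑ j, (S j ^ 2) ^ (γ / 2) := by
          simpa only [Finset.card_univ, Fintype.card_fin] using
            Real.rpow_sum_le_const_mul_sum_rpow_of_nonneg Finset.univ (by linarith : 1 ≤ γ / 2)
              fun j _ => sq_nonneg (S j)
      _ = (p T : ℝ) ^ (γ / 2 - 1) * ∑ j, S j ^ γ := by
          simp only [hsq _ (abs_nonneg _), hS]
  calc estError p X e β T ω ^ γ ≤ (l⁻¹ * ((T : ℝ)⁻¹ * √(∑ j, S j ^ 2))) ^ γ :=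
        Real.rpow_le_rpow (estError_nonneg e β T ω) (estError_le e β hl hspec) (by linarith)
    _ = l⁻¹ ^ γ * ((T : ℝ)⁻¹ ^ γ * √(∑ j, S j ^ 2) ^ γ) := by
        rw [Real.mul_rpow (by positivity) (by positivity),
          Real.mul_rpow (by positivity) (by positivity)]
    _ ≤ _ := by gcongr

variable {e}

theorem aemeasurable_estError [MeasurableSpace Ω] {μ : Measure Ω}
    (hX : ∀ T t j, Measurable (X T t j)) (he : ∀ t, AEMeasurable (e t) μ) (T : ℕ) :
    AEMeasurable (estError p X e β T) μ := by
  have hD : ∀ t j, Measurable fun ω => designMatrix p X T ω t j := fun t j => hX _ _ _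
  have hInv := measurable_matrix_inv_apply (A := fun ω =>
    (designMatrix p X T ω).transpose * designMatrix p X T ω) fun i j => by
      simp only [Matrix.mul_apply, Matrix.transpose_apply]
      exact Finset.measurable_sum _ fun t _ => (hD _ _).mul (hD _ _)
  have hLS : ∀ j, AEMeasurable (fun ω => leastSquares p X e β T ω j) μ := fun j => by
    simp only [leastSquares, Matrix.mulVec, dotProduct, Matrix.mul_apply, Matrix.transpose_apply,
      response]
    refine Finset.aemeasurable_fun_sum _ fun t _ => ?_
    refine (Finset.measurable_sum _ fun i _ => (hInv j i).mul (hD _ _)).aemeasurable.mul ?_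
    exact (Finset.measurable_sum _ fun i _ => (hD _ _).mul_const _).aemeasurable.add (he _)
  exact (PiLp.continuous_toLp 2 _).norm.measurable.comp_aemeasurable
    ((aemeasurable_pi_lambda _ hLS).sub_const _)

end LeastSquares

section Consistency

variable {Ω : Type*} [MeasurableSpace Ω] {μ : Measure Ω} {T₀ : ℕ} {p : ℕ → ℕ}
  {X : ℕ → ℕ → ℕ → Ω → ℝ}

theorem isCoboundedUnder_ge_ae [NeZero μ] (f : Ω → ℝ) :
    IsCoboundedUnder (· ≥ ·) (ae μ) f := by
  suffices ∃ n : ℕ, ∃ᶠ ω in ae μ, f ω ≤ n from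
    let ⟨_, hn⟩ := this
    IsCoboundedUnder.of_frequently_le hn
  by_contra! h
  have hlt : ∀ᵐ ω ∂μ, ∀ n : ℕ, n < f ω := ae_all_iff.2 h
  obtain ⟨ω, hω⟩ := hlt.exists
  obtain ⟨n, hn⟩ := exists_nat_ge (f ω)
  exact (hω n).not_ge hn

section LamMin

variable {a : ℝ} (hspec : ∀ T ≥ T₀, ∀ᵐ ω ∂μ, spectrum ℝ (gramMatrix p X T ω) ⊆ Set.Ici a)
  (hp : ∃ T ≥ T₀, p T ≠ 0)

include hspec in
theorem ae_mem_lowerBounds_spectrum : ∀ᵐ ω ∂μ,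
    a ∈ lowerBounds {l : ℝ | ∃ T ≥ T₀, l ∈ spectrum ℝ (gramMatrix p X T ω)} := by
  filter_upwards [ae_all_iff.2 fun T => ae_all_iff.2 fun hT => hspec T hT] with ω h
  exact fun x ⟨T, hT, hx⟩ => h T hT hx

include hspec hp

theorem ae_le_sInf_spectrum : ∀ᵐ ω ∂μ,
    a ≤ sInf {l : ℝ | ∃ T ≥ T₀, l ∈ spectrum ℝ (gramMatrix p X T ω)} := by
  obtain ⟨T, hT, hpT⟩ := hp
  filter_upwards [ae_mem_lowerBounds_spectrum hspec] with ω hω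
  exact le_csInf ⟨_, T, hT, (gramMatrix_isHermitian T ω).eigenvalues_mem_spectrum_real
    ⟨0, Nat.pos_of_ne_zero hpT⟩⟩ hω

theorem le_lamMin [NeZero μ] : a ≤ lamMin μ T₀ p X :=
  le_essInf_of_ae_le a (ae_le_sInf_spectrum hspec hp) (isCoboundedUnder_ge_ae _)

theorem ae_spectrum_subset_Ici_lamMin :
    ∀ᵐ ω ∂μ, ∀ T ≥ T₀, spectrum ℝ (gramMatrix p X T ω) ⊆ Set.Ici (lamMin μ T₀ p X) := by
  filter_upwards [ae_essInf_le ⟨a, ae_le_sInf_spectrum hspec hp⟩,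
    ae_mem_lowerBounds_spectrum hspec] with ω hω ha T hT x hx
  exact hω.trans (csInf_le ⟨a, ha⟩ ⟨T, hT, hx⟩)

end LamMin

theorem GrowthOfSumMoment.const_nonneg {e : ℕ → Ω → ℝ} {γ' Cν : ℝ}
    (hG : GrowthOfSumMoment μ T₀ p X e γ' Cν) (hγ' : 2 ≤ γ') {T : ℕ} (hT : T₀ ≤ T)
    (hp : p T ≠ 0) : 0 ≤ Cν := by
  have h := (hG 2 le_rfl hγ' T hT 1 0 (Nat.pos_of_ne_zero hp)).2
  rw [Nat.cast_one, Real.one_rpow, mul_one] at h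
  exact (integral_nonneg fun ω => by positivity).trans h

theorem inv_rpow_mul_rpow_mul_mul_eq_sqrt_div_rpow {p T γ : ℝ} (hp : 0 ≤ p) (hT : 0 ≤ T)
    (hγ : 0 < γ) (c : ℝ) :
    T⁻¹ ^ γ * (p ^ (γ / 2 - 1) * (p * (c * T ^ (γ / 2)))) = c * √(p / T) ^ γ := by
  rcases hp.eq_or_lt with rfl | hp
  · simp [Real.zero_rpow hγ.ne']
  rcases hT.eq_or_lt with rfl | hT
  · simp [Real.zero_rpow hγ.ne']
  have hsq : T ^ γ = T ^ (γ / 2) * T ^ (γ / 2) := by rw [← Real.rpow_add hT, add_halves]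
  rw [Real.sqrt_eq_rpow, ← Real.rpow_mul (by positivity), one_div_mul_eq_div,
    Real.div_rpow hp.le hT.le, Real.rpow_sub_one hp.ne', Real.inv_rpow hT.le, hsq]
  field_simp

section Moments

variable (hX : ∀ T t j, Measurable (X T t j)) {e : ℕ → Ω → ℝ} (he : ∀ t, AEMeasurable (e t) μ)
  {γ' Cν : ℝ} (hG : GrowthOfSumMoment μ T₀ p X e γ' Cν) (β : ∀ T, Fin (p T) → ℝ) {γ : ℝ}
  (hγ : 2 ≤ γ) (hγ' : γ ≤ γ') {T : ℕ} (hT : T₀ ≤ T) {l : ℝ} (hl : 0 < l)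
  (hspec : ∀ᵐ ω ∂μ, spectrum ℝ (gramMatrix p X T ω) ⊆ Set.Ici l)

include hX he hG hγ hγ' hT hl hspec

theorem integrable_estError_rpow : Integrable (fun ω => estError p X e β T ω ^ γ) μ := by
  refine Integrable.mono' ((((integrable_finsetSum Finset.univ fun (j : Fin (p T)) _ =>
    (hG γ hγ hγ' T hT T j j.2).1).const_mul ((p T : ℝ) ^ (γ / 2 - 1))).const_mul
    ((T : ℝ)⁻¹ ^ γ)).const_mul (l⁻¹ ^ γ))
    ((aemeasurable_estError β hX he T).pow_const γ).aestronglyMeasurable ?_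
  filter_upwards [hspec] with ω hω
  rw [Real.norm_of_nonneg (Real.rpow_nonneg (estError_nonneg e β T ω) _)]
  exact estError_rpow_le e β hl hω hγ

theorem integral_estError_rpow_le :
    ∫ ω, estError p X e β T ω ^ γ ∂μ ≤ l⁻¹ ^ γ * (Cν * √((p T : ℝ) / T) ^ γ) := by
  have hint (j : Fin (p T)) := hG γ hγ hγ' T hT T j j.2
  calc ∫ ω, estError p X e β T ω ^ γ ∂μ
      ≤ ∫ ω, l⁻¹ ^ γ * ((T : ℝ)⁻¹ ^ γ * ((p T : ℝ) ^ (γ / 2 - 1) *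
          ∑ j : Fin (p T), |∑ t ∈ Finset.Icc 1 T, X T t j ω * e t ω| ^ γ)) ∂μ :=
        integral_mono_ae (integrable_estError_rpow hX he hG β hγ hγ' hT hl hspec)
          ((((integrable_finsetSum _ fun j _ => (hint j).1).const_mul _).const_mul _).const_mul _)
          (hspec.mono fun ω hω => estError_rpow_le e β hl hω hγ)
    _ = l⁻¹ ^ γ * ((T : ℝ)⁻¹ ^ γ * ((p T : ℝ) ^ (γ / 2 - 1) *
          ∑ j : Fin (p T), ∫ ω, |∑ t ∈ Finset.Icc 1 T, X T t j ω * e t ω| ^ γ ∂μ)) := by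
        simp only [integral_const_mul]
        rw [integral_finsetSum _ fun j _ => (hint j).1]
    _ ≤ l⁻¹ ^ γ * ((T : ℝ)⁻¹ ^ γ * ((p T : ℝ) ^ (γ / 2 - 1) *
          ∑ _j : Fin (p T), Cν * (T : ℝ) ^ (γ / 2))) := by
        gcongr with j
        exact (hint j).2
    _ = l⁻¹ ^ γ * (Cν * √((p T : ℝ) / T) ^ γ) := by
        rw [Finset.sum_const, Finset.card_univ, Fintype.card_fin, nsmul_eq_mul,
          inv_rpow_mul_rpow_mul_mul_eq_sqrt_div_rpow (by positivity) (by positivity) (by linarith)]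

theorem measureReal_lt_estError_le [IsFiniteMeasure μ] {δ : ℝ} (hδ : 0 < δ) :
    μ.real {ω | δ < estError p X e β T ω} ≤
      l⁻¹ ^ γ * (Cν * √((p T : ℝ) / T) ^ γ) * δ ^ (-γ) := by
  have hδγ := Real.rpow_pos_of_pos hδ γ
  have hmarkov := mul_meas_ge_le_integral_of_nonneg
    (ae_of_all μ fun ω => Real.rpow_nonneg (estError_nonneg e β T ω) γ)
    (integrable_estError_rpow hX he hG β hγ hγ' hT hl hspec) (δ ^ γ)
  rw [Real.rpow_neg hδ.le, ← div_eq_mul_inv, le_div_iff₀' hδγ]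
  calc δ ^ γ * μ.real {ω | δ < estError p X e β T ω}
      ≤ δ ^ γ * μ.real {ω | δ ^ γ ≤ estError p X e β T ω ^ γ} := by
        refine mul_le_mul_of_nonneg_left (measureReal_mono fun ω (hω : δ < _) => ?_) hδγ.le
        exact Real.rpow_le_rpow hδ.le hω.le (by linarith)
    _ ≤ _ := hmarkov.trans (integral_estError_rpow_le hX he hG β hγ hγ' hT hl hspec)

end Moments

section Rate

variable {η : ℝ} (h : RateCondition T₀ p η)

include h

theorem RateCondition.tendsto_div : Tendsto (fun T => (p T : ℝ) / T) atTop (𝓝 0) := by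
  rcases le_or_gt η (1 / 2) with hη | hη
  · exact (h.1 hη).2
  refine squeeze_zero (fun T => by positivity) (fun T => ?_) (h.2 hη)
  gcongr
  rcases Nat.eq_zero_or_pos (p T) with hp | hp
  · rw [hp, Nat.cast_zero]
    positivity
  · exact Real.self_le_rpow_of_one_le (by exact_mod_cast hp) (by linarith)

theorem RateCondition.eventually_rpow_le :
    ∀ᶠ T : ℕ in atTop, (p T : ℝ) ^ (2 * η) ≤ T := by
  rcases le_or_gt η (1 / 2) with hη | hη
  · filter_upwards [eventually_ge_atTop T₀, eventually_ge_atTop 1] with T hT hT1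
    rcases Nat.eq_zero_or_pos (p T) with hp | hp
    · rw [hp, Nat.cast_zero]
      exact Real.zero_rpow_le_one _ |>.trans (by exact_mod_cast hT1)
    · calc (p T : ℝ) ^ (2 * η) ≤ (p T : ℝ) ^ (1 : ℝ) :=
            Real.rpow_le_rpow_of_exponent_le (by exact_mod_cast hp) (by linarith)
        _ = p T := Real.rpow_one _
        _ ≤ T := by exact_mod_cast (h.1 hη).1 T hT
  · filter_upwards [(h.2 hη).eventually_lt_const one_pos, eventually_gt_atTop 0] with T hT hT0
    exact ((div_lt_one (by exact_mod_cast hT0)).1 hT).le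

theorem RateCondition.tendsto_meanSquareBound (Cν C' : ℝ) :
    Tendsto (meanSquareBound μ T₀ p X η Cν C') atTop (𝓝 0) := by
  unfold meanSquareBound
  refine bdd_le_mul_tendsto_zero' ((|C'| + |(lamMin μ T₀ p X)⁻¹|) ^ 2 * |Cν|) ?_ h.tendsto_div
  filter_upwards [h.eventually_rpow_le] with T hT
  have hle : (p T : ℝ) ^ η / √(T : ℝ) ≤ 1 := by
    refine div_le_one_of_le₀ (Real.le_sqrt_of_sq_le ?_) (Real.sqrt_nonneg _)
    rwa [← Real.rpow_mul_natCast (by positivity), Nat.cast_ofNat, mul_comm]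
  rw [abs_mul, abs_pow, mul_div_assoc]
  gcongr
  refine (abs_add_le _ _).trans ?_
  rw [abs_mul, abs_of_nonneg (by positivity : 0 ≤ (p T : ℝ) ^ η / √(T : ℝ))]
  gcongr
  exact mul_le_of_le_one_right (abs_nonneg _) hle

end Rate

section

variable (hT₀ : 1 ≤ T₀) (hX : ∀ T t j, Measurable (X T t j)) {a : ℝ} (ha : 0 < a)
  (hspec : ∀ T ≥ T₀, ∀ᵐ ω ∂μ, spectrum ℝ (gramMatrix p X T ω) ⊆ Set.Ici a)
  {γ' : ℝ} (hγ' : 2 ≤ γ') {e : ℕ → Ω → ℝ} (he : ∀ t, AEMeasurable (e t) μ) {Cν : ℝ}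
  (hG : GrowthOfSumMoment μ T₀ p X e γ' Cν) (β : ∀ T, Fin (p T) → ℝ)

include hX ha hspec hγ' he hG

include hT₀ in
theorem exists_forall_measureReal_mul_sqrt_lt_estError_le [IsFiniteMeasure μ] {ε : ℝ} (hε : 0 < ε) :
    ∃ M > (0 : ℝ), ∀ T ≥ T₀, μ.real {ω | M * √((p T : ℝ) / T) < estError p X e β T ω} ≤ ε := by
  set κ : ℝ := a⁻¹ ^ 2 * |Cν| with hκ
  refine ⟨√((κ + 1) / ε), by positivity, fun T hT => ?_⟩
  by_cases hp : p T = 0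
  · simp [estError_eq_zero_of_eq_zero e β hp, hp, hε.le]
  have hT0 : (0 : ℝ) < T := by exact_mod_cast hT₀.trans hT
  have : (0 : ℝ) < p T := by exact_mod_cast Nat.pos_of_ne_zero hp
  have hCν := hG.const_nonneg hγ' hT hp
  calc μ.real {ω | √((κ + 1) / ε) * √((p T : ℝ) / T) < estError p X e β T ω}
      ≤ a⁻¹ ^ (2 : ℝ) * (Cν * √((p T : ℝ) / T) ^ (2 : ℝ)) *
          (√((κ + 1) / ε) * √((p T : ℝ) / T)) ^ (-2 : ℝ) :=
        measureReal_lt_estError_le hX he hG β le_rfl hγ' hT ha (hspec T hT) (by positivity)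
    _ = κ / (κ + 1) * ε := by
        rw [Real.rpow_neg (by positivity), Real.rpow_two, Real.rpow_two, Real.rpow_two, mul_pow,
          Real.sq_sqrt (by positivity), Real.sq_sqrt (by positivity), hκ, abs_of_nonneg hCν]
        field_simp
    _ ≤ ε := mul_le_of_le_one_left hε.le ((div_le_one (by positivity)).2 (by linarith))

variable [NeZero μ]

theorem integral_estError_sq_le_meanSquareBound (η : ℝ) {C' : ℝ} (hC' : 0 ≤ C') {T : ℕ}
    (hT : T₀ ≤ T) : Integrable (fun ω => estError p X e β T ω ^ 2) μ ∧
      ∫ ω, estError p X e β T ω ^ 2 ∂μ ≤ meanSquareBound μ T₀ p X η Cν C' T := by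
  by_cases hp : p T = 0
  · simp [estError_eq_zero_of_eq_zero e β hp, meanSquareBound, hp]
  have hlam : 0 < lamMin μ T₀ p X := ha.trans_le (le_lamMin hspec ⟨T, hT, hp⟩)
  have hspec_lam : ∀ᵐ ω ∂μ, spectrum ℝ (gramMatrix p X T ω) ⊆ Set.Ici (lamMin μ T₀ p X) :=
    (ae_spectrum_subset_Ici_lamMin hspec ⟨T, hT, hp⟩).mono fun ω h => h T hT
  have hCν := hG.const_nonneg hγ' hT hp
  simp only [← Real.rpow_two]
  refine ⟨integrable_estError_rpow hX he hG β le_rfl hγ' hT hlam hspec_lam,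
    (integral_estError_rpow_le hX he hG β le_rfl hγ' hT hlam hspec_lam).trans ?_⟩
  rw [Real.rpow_two, Real.rpow_two, Real.sq_sqrt (by positivity), meanSquareBound, mul_assoc]
  gcongr
  exact le_add_of_nonneg_left (by positivity)

theorem consistencyAssertions_of_growthOfSumMoment [IsFiniteMeasure μ] (hT₀ : 1 ≤ T₀) {η : ℝ}
    (hrate : RateCondition T₀ p η) :
    ConsistencyAssertions μ T₀ p X η e γ' Cν (max 1 a⁻¹ ^ γ') 1 where
  tail β γ hγ hγγ' δ hδ T hT := by
    have hnonneg : 0 ≤ Cν * √((p T : ℝ) / T) ^ γ := by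
      rcases eq_or_ne (p T) 0 with hp | hp
      · simp [hp, Real.zero_rpow (by linarith : γ ≠ 0)]
      · have := hG.const_nonneg hγ' hT hp
        positivity
    have hconst : a⁻¹ ^ γ ≤ max 1 a⁻¹ ^ γ' :=
      (Real.rpow_le_rpow (by positivity) (le_max_right 1 _) (by linarith)).trans
        (Real.rpow_le_rpow_of_exponent_le (le_max_left _ _) hγγ')
    refine (measureReal_lt_estError_le hX he hG β hγ hγγ' hT ha (hspec T hT) hδ).trans ?_
    rw [mul_assoc (max 1 a⁻¹ ^ γ')]
    gcongr
  bigOP β _ hε :=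
    exists_forall_measureReal_mul_sqrt_lt_estError_le hT₀ hX ha hspec hγ' he hG β hε
  meanSquare β _ hT :=
    integral_estError_sq_le_meanSquareBound hX ha hspec hγ' he hG β η zero_le_one hT
  bound_tendsto := hrate.tendsto_meanSquareBound Cν 1

end

end Consistency

open scoped ENNReal NNReal

section Series

theorem tsum_tsum_nat_add_eq (f : ℕ → ℝ≥0∞) :
    ∑' K, ∑' j, f (j + K) = ∑' n : ℕ, (n + 1) * f n := by
  rw [← ENNReal.tsum_prod (f := fun K j => f (j + K)),
    ← Finset.HasAntidiagonal.sigmaAntidiagonalEquivProd.tsum_eq, ENNReal.tsum_sigma']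
  refine tsum_congr fun n => ?_
  have h (x : Finset.HasAntidiagonal.antidiagonal n) : f (x.1.2 + x.1.1) = f n := by
    rw [add_comm, Finset.HasAntidiagonal.mem_antidiagonal.1 x.2]
  simp [h]

theorem tsum_comp_tsub_ne_top {f : ℕ → ℝ≥0∞} (hf : ∑' n, f n ≠ ∞) (m : ℕ) :
    ∑' n, f (n - m) ≠ ∞ := by
  rw [← Summable.sum_add_tsum_nat_add' (k := m) ENNReal.summable]
  simp only [Nat.add_sub_cancel]
  exact ENNReal.add_ne_top.2
    ⟨ENNReal.sum_ne_top.2 fun n _ => ENNReal.ne_top_of_tsum_ne_top hf (n - m), hf⟩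

theorem sum_natAbs_sub_le_two_mul_tsum (ρ : ℕ → ℝ≥0∞) (s : ℕ) (I : Finset ℕ) :
    ∑ t ∈ I, ρ ((t : ℤ) - s).natAbs ≤ 2 * ∑' n, ρ n := by
  have hpast : ∑ t ∈ I with t < s, ρ (s - t) ≤ ∑' n, ρ n := by
    rw [← Finset.sum_image fun t ht t' ht' h => ?_]
    · exact ENNReal.sum_le_tsum _
    · simp only [Finset.coe_filter, Set.mem_ofPred_eq] at ht ht'
      lia
  have hfuture : ∑ t ∈ I with ¬ t < s, ρ (t - s) ≤ ∑' n, ρ n := by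
    rw [← Finset.sum_image fun t ht t' ht' h => ?_]
    · exact ENNReal.sum_le_tsum _
    · simp only [Finset.coe_filter, Set.mem_ofPred_eq] at ht ht'
      lia
  rw [← Finset.sum_filter_add_sum_filter_not I (· < s), two_mul]
  refine add_le_add (le_of_eq_of_le (Finset.sum_congr rfl fun t ht => ?_) hpast)
    (le_of_eq_of_le (Finset.sum_congr rfl fun t ht => ?_) hfuture) <;>
  · rw [Finset.mem_filter] at ht
    congr 1
    lia

theorem sum_abs_le_two_mul_toReal_tsum {c : ℕ → ℕ → ℝ} (hsymm : ∀ s t, c s t = c t s)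
    {ρ : ℕ → ℝ≥0∞} (hρ : ∑' n, ρ n ≠ ∞) (hc : ∀ s t, s ≤ t → ‖c s t‖ₑ ≤ ρ (t - s)) (s : ℕ)
    (I : Finset ℕ) : ∑ t ∈ I, |c s t| ≤ 2 * (∑' n, ρ n).toReal := by
  have hle (t : ℕ) : ‖c s t‖ₑ ≤ ρ ((t : ℤ) - s).natAbs := by
    rcases le_total s t with hst | hts
    · simpa only [show ((t : ℤ) - s).natAbs = t - s by lia] using hc s t hst
    · simpa only [show ((t : ℤ) - s).natAbs = s - t by lia, hsymm s t] using hc t s hts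
  have hsum : ∑ t ∈ I, ‖c s t‖ₑ ≤ 2 * ∑' n, ρ n :=
    (Finset.sum_le_sum fun t _ => hle t).trans (sum_natAbs_sub_le_two_mul_tsum ρ s I)
  simpa [ENNReal.toReal_sum, ENNReal.toReal_mul] using
    ENNReal.toReal_mono (ENNReal.mul_ne_top ENNReal.ofNat_ne_top hρ) hsum

end Series

section LpSpace

variable {Ω : Type*} [MeasurableSpace Ω] {μ : Measure Ω}

section NormedSpace

variable {E : Type*} [NormedAddCommGroup E] {q : ℝ≥0∞}

theorem eLpNorm_tsum_le [CompleteSpace E] (hq : 1 ≤ q) {f : ℕ → Ω → E}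
    (hf : ∀ j, AEStronglyMeasurable (f j) μ) :
    eLpNorm (fun ω => ∑' j, f j ω) q μ ≤ ∑' j, eLpNorm (f j) q μ := by
  by_cases htop : ∑' j, eLpNorm (f j) q μ = ∞
  · exact htop ▸ le_top
  have hlim : ∀ᵐ ω ∂μ, Tendsto (fun R => (∑ j ∈ Finset.range R, f j) ω) atTop
      (𝓝 (∑' j, f j ω)) := by
    filter_upwards [summable_norm_of_tsum_eLpNorm_ne_top hq hf htop] with ω hω
    simpa only [Finset.sum_apply] using hω.of_norm.hasSum.tendsto_sum_nat
  calc eLpNorm (fun ω => ∑' j, f j ω) q μ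
      ≤ liminf (fun R => eLpNorm (∑ j ∈ Finset.range R, f j) q μ) atTop :=
        Lp.eLpNorm_lim_le_liminf_eLpNorm
          (fun R => Finset.aestronglyMeasurable_sum _ fun j _ => hf j) _ hlim
    _ ≤ liminf (fun _ : ℕ => ∑' j, eLpNorm (f j) q μ) atTop :=
        liminf_le_liminf <| Eventually.of_forall fun R =>
          (eLpNorm_sum_le (fun j _ => hf j) hq).trans (ENNReal.sum_le_tsum _)
    _ = ∑' j, eLpNorm (f j) q μ := liminf_const _

theorem eLpNorm_tsum_sub_sum_range_le [CompleteSpace E] (hq : 1 ≤ q) {f : ℕ → Ω → E}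
    (hf : ∀ j, AEStronglyMeasurable (f j) μ) (hsum : ∑' j, eLpNorm (f j) q μ ≠ ∞) (K : ℕ) :
    eLpNorm (fun ω => ∑' j, f j ω - ∑ j ∈ Finset.range K, f j ω) q μ ≤
      ∑' j, eLpNorm (f (j + K)) q μ := by
  have htail : (fun ω => ∑' j, f j ω - ∑ j ∈ Finset.range K, f j ω) =ᵐ[μ]
      fun ω => ∑' j, f (j + K) ω := by
    filter_upwards [summable_norm_of_tsum_eLpNorm_ne_top hq hf hsum] with ω hω
    rw [← hω.of_norm.sum_add_tsum_nat_add K, add_sub_cancel_left]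
  rw [eLpNorm_congr_ae htail]
  exact eLpNorm_tsum_le hq fun j => hf (j + K)

theorem eLpNorm_sub_integral_le [NormedSpace ℝ E] [IsProbabilityMeasure μ] (hq : 1 ≤ q)
    {f : Ω → E} (hf : AEStronglyMeasurable f μ) :
    eLpNorm (fun ω => f ω - ∫ ω', f ω' ∂μ) q μ ≤ 2 * eLpNorm f q μ := by
  have hmean : eLpNorm (fun _ : Ω => ∫ ω', f ω' ∂μ) q μ ≤ eLpNorm f q μ := by
    rw [eLpNorm_const _ (one_pos.trans_le hq).ne' (NeZero.ne μ), measure_univ, ENNReal.one_rpow,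
      mul_one]
    calc ‖∫ ω', f ω' ∂μ‖ₑ ≤ eLpNorm f 1 μ := by
          rw [eLpNorm_one_eq_lintegral_enorm]
          exact enorm_integral_le_lintegral_enorm f
      _ ≤ eLpNorm f q μ := eLpNorm_le_eLpNorm_of_exponent_le hq hf
  rw [two_mul]
  exact (eLpNorm_sub_le hf aestronglyMeasurable_const hq).trans (add_le_add le_rfl hmean)

end NormedSpace

theorem enorm_integral_mul_le_eLpNorm_mul_eLpNorm {𝕜 : Type*} [RCLike 𝕜] {f g : Ω → 𝕜}
    (hf : AEStronglyMeasurable f μ) (hg : AEStronglyMeasurable g μ) :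
    ‖∫ ω, f ω * g ω ∂μ‖ₑ ≤ eLpNorm f 2 μ * eLpNorm g 2 μ :=
  calc ‖∫ ω, f ω * g ω ∂μ‖ₑ ≤ eLpNorm (f • g) 1 μ := by
        rw [eLpNorm_one_eq_lintegral_enorm]
        exact enorm_integral_le_lintegral_enorm _
    _ ≤ eLpNorm f 2 μ * eLpNorm g 2 μ := eLpNorm_smul_le_mul_eLpNorm hg hf

/-- Replacing `g` by `g'`, which is uncorrelated with the centred `f`, leaves the integral
unchanged. -/
theorem enorm_integral_mul_sub_const_le_of_indepFun [IsFiniteMeasure μ] {f g g' : Ω → ℝ}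
    (hf : MemLp f 2 μ) (hf₀ : ∫ ω, f ω ∂μ = 0) (hg : MemLp g 2 μ) (hg' : MemLp g' 2 μ)
    (hfg' : IndepFun f g' μ) (c : ℝ) :
    ‖∫ ω, f ω * (g ω - c) ∂μ‖ₑ ≤ eLpNorm f 2 μ * eLpNorm (fun ω => g ω - g' ω) 2 μ := by
  have hfg : Integrable (fun ω => f ω * g ω) μ := hf.integrable_mul hg
  have hfg'_int : Integrable (fun ω => f ω * g' ω) μ := hf.integrable_mul hg'
  have hzero : ∫ ω, f ω * g' ω ∂μ = 0 := by
    rw [hfg'.integral_fun_mul_eq_mul_integral hf.1 hg'.1, hf₀, zero_mul]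
  have hswap : ∫ ω, f ω * (g ω - c) ∂μ = ∫ ω, f ω * (g ω - g' ω) ∂μ := by
    simp only [mul_sub]
    rw [integral_sub hfg ((hf.integrable one_le_two).mul_const c),
      integral_sub hfg hfg'_int, integral_mul_const, hf₀, zero_mul, hzero]
  rw [hswap]
  exact enorm_integral_mul_le_eLpNorm_mul_eLpNorm hf.1 (hg.sub hg').1

end LpSpace

section WeightedSums

variable {Ω ι : Type*} [MeasurableSpace Ω] {μ : Measure Ω} {x e : ι → Ω → ℝ} {B : ℝ}
  {I : Finset ι}

theorem memLp_sum_mul_of_bounded {q : ℝ≥0∞} (hx : ∀ i ∈ I, AEStronglyMeasurable (x i) μ)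
    (hB : ∀ i ∈ I, ∀ᵐ ω ∂μ, |x i ω| ≤ B) (he : ∀ i ∈ I, MemLp (e i) q μ) :
    MemLp (fun ω => ∑ i ∈ I, x i ω * e i ω) q μ :=
  memLp_finsetSum _ fun i hi => by
    refine (he i hi).of_le_mul (c := B) ((hx i hi).mul (he i hi).1) ?_
    filter_upwards [hB i hi] with ω hω
    rw [norm_mul]
    exact mul_le_mul_of_nonneg_right hω (norm_nonneg _)

theorem integral_mul_mul_le_of_indepFun [IsProbabilityMeasure μ] {w v : Ω → ℝ} {b : ℝ}
    (hw : AEStronglyMeasurable w μ) (hb : ∀ᵐ ω ∂μ, |w ω| ≤ b) (hv : AEStronglyMeasurable v μ)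
    (hwv : IndepFun w v μ) : ∫ ω, w ω * v ω ∂μ ≤ b * |∫ ω, v ω ∂μ| := by
  rw [hwv.integral_fun_mul_eq_mul_integral hw hv]
  refine (le_abs_self _).trans ?_
  rw [abs_mul]
  gcongr
  simpa using norm_integral_le_of_norm_le_const (f := w) hb

theorem integral_sum_mul_sq_le [IsProbabilityMeasure μ]
    (hx : ∀ i ∈ I, AEStronglyMeasurable (x i) μ) (hB : ∀ i ∈ I, ∀ᵐ ω ∂μ, |x i ω| ≤ B)
    (he : ∀ i ∈ I, MemLp (e i) 2 μ)
    (hxe : IndepFun (fun ω i => x i ω) (fun ω i => e i ω) μ) {Q : ℝ}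
    (hQ : ∀ i ∈ I, ∑ j ∈ I, |∫ ω, e i ω * e j ω ∂μ| ≤ Q) :
    ∫ ω, (∑ i ∈ I, x i ω * e i ω) ^ 2 ∂μ ≤ B ^ 2 * Q * I.card := by
  have hxx : ∀ i ∈ I, ∀ j ∈ I, ∀ᵐ ω ∂μ, |x i ω * x j ω| ≤ B ^ 2 := fun i hi j hj => by
    filter_upwards [hB i hi, hB j hj] with ω h₁ h₂
    rw [abs_mul, sq]
    exact mul_le_mul h₁ h₂ (abs_nonneg _) ((abs_nonneg _).trans h₁)
  have hee : ∀ i ∈ I, ∀ j ∈ I, Integrable (fun ω => e i ω * e j ω) μ :=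
    fun i hi j hj => (he i hi).integrable_mul (he j hj)
  have hint : ∀ i ∈ I, ∀ j ∈ I, Integrable (fun ω => x i ω * x j ω * (e i ω * e j ω)) μ :=
    fun i hi j hj => (hee i hi j hj).bdd_mul ((hx i hi).mul (hx j hj)) (hxx i hi j hj)
  have hpair (i j : ι) : IndepFun (fun ω => x i ω * x j ω) (fun ω => e i ω * e j ω) μ :=
    hxe.comp (φ := fun v : ι → ℝ => v i * v j) (ψ := fun v : ι → ℝ => v i * v j)
      (by fun_prop) (by fun_prop)
  calc ∫ ω, (∑ i ∈ I, x i ω * e i ω) ^ 2 ∂μ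
      = ∫ ω, ∑ i ∈ I, ∑ j ∈ I, x i ω * x j ω * (e i ω * e j ω) ∂μ := by
        simp only [sq, Finset.sum_mul_sum, mul_mul_mul_comm]
    _ = ∑ i ∈ I, ∑ j ∈ I, ∫ ω, x i ω * x j ω * (e i ω * e j ω) ∂μ := by
        rw [integral_finsetSum _ fun i hi => integrable_finsetSum _ (hint i hi)]
        exact Finset.sum_congr rfl fun i hi => integral_finsetSum _ (hint i hi)
    _ ≤ ∑ i ∈ I, ∑ j ∈ I, B ^ 2 * |∫ ω, e i ω * e j ω ∂μ| :=
        Finset.sum_le_sum fun i hi => Finset.sum_le_sum fun j hj =>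
          integral_mul_mul_le_of_indepFun ((hx i hi).mul (hx j hj)) (hxx i hi j hj)
            (hee i hi j hj).1 (hpair i j)
    _ ≤ ∑ i ∈ I, B ^ 2 * Q := Finset.sum_le_sum fun i hi => by
        rw [← Finset.mul_sum]
        exact mul_le_mul_of_nonneg_left (hQ i hi) (sq_nonneg B)
    _ = B ^ 2 * Q * I.card := by rw [Finset.sum_const, nsmul_eq_mul, mul_comm]

end WeightedSums

theorem sqrt_sum_sum_sq_le {ι κ : Type*} [Fintype ι] [Fintype κ] (x : ι → κ → ℝ) :
    √(∑ i, ∑ k, x i k ^ 2) ≤ ∑ i, ∑ k, |x i k| := by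
  refine Real.sqrt_le_iff.2 ⟨by positivity, ?_⟩
  simp only [← Fintype.sum_prod_type', ← sq_abs (x _ _)]
  exact Finset.sum_sq_le_sq_sum_of_nonneg fun _ _ => abs_nonneg _

theorem nnnorm_mulVec_le {ι κ : Type*} [Fintype ι] [Fintype κ] (A : Matrix ι κ ℝ) (v : κ → ℝ) :
    ‖A.mulVec v‖₊ ≤ (∑ i, ∑ k, ‖A i k‖₊) * ‖v‖₊ :=
  pi_nnnorm_le_iff.2 fun i =>
    calc ‖A.mulVec v i‖₊ ≤ ∑ k, ‖A i k‖₊ * ‖v‖₊ := nnnorm_sum_le_of_le _ fun k _ => by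
          rw [nnnorm_mul]
          exact mul_le_mul_right (nnnorm_le_pi_nnnorm v k) _
      _ = (∑ k, ‖A i k‖₊) * ‖v‖₊ := (Finset.sum_mul ..).symm
      _ ≤ (∑ i, ∑ k, ‖A i k‖₊) * ‖v‖₊ := by
          gcongr
          exact Finset.single_le_sum (f := fun i => ∑ k, ‖A i k‖₊) (fun _ _ => zero_le)
            (Finset.mem_univ i)

theorem eLpNorm_pi_le_sum {Ω ι : Type*} [MeasurableSpace Ω] {μ : Measure Ω} [Fintype ι]
    {f : Ω → ι → ℝ} (hf : AEStronglyMeasurable f μ) {q : ℝ≥0∞} (hq : 1 ≤ q) :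
    eLpNorm f q μ ≤ ∑ i, eLpNorm (fun ω => f ω i) q μ :=
  calc eLpNorm f q μ ≤ eLpNorm (∑ i, fun ω => ‖f ω i‖) q μ :=
        eLpNorm_mono_real fun ω => by
          rw [Finset.sum_apply]
          exact (pi_norm_le_iff_of_nonneg (Finset.sum_nonneg fun _ _ => norm_nonneg _)).2 fun i =>
            Finset.single_le_sum (f := fun i => ‖f ω i‖) (fun _ _ => norm_nonneg _)
              (Finset.mem_univ i)
    _ ≤ ∑ i, eLpNorm (fun ω => ‖f ω i‖) q μ :=
        eLpNorm_sum_le (fun i _ => ((continuous_apply i).comp_aestronglyMeasurable hf).norm) hq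
    _ = ∑ i, eLpNorm (fun ω => f ω i) q μ := Finset.sum_congr rfl fun _ _ => eLpNorm_norm _

theorem eLpNorm_le_of_integral_abs_pow_le {Ω : Type*} [MeasurableSpace Ω] {μ : Measure Ω}
    {f : Ω → ℝ} (hf : AEStronglyMeasurable f μ) {n : ℕ} (hn : n ≠ 0)
    (hint : Integrable (fun ω => |f ω| ^ n) μ) {K : ℝ} (hK : ∫ ω, |f ω| ^ n ∂μ ≤ K) :
    eLpNorm f n μ ≤ ENNReal.ofReal (K ^ (n⁻¹ : ℝ)) := by
  have hn' : (n : ℝ≥0∞) ≠ 0 := Nat.cast_ne_zero.2 hn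
  have hLp : MemLp f n μ :=
    (integrable_norm_rpow_iff hf hn' (ENNReal.natCast_ne_top n)).1 (by simpa using hint)
  rw [hLp.eLpNorm_eq_integral_rpow_norm hn' (ENNReal.natCast_ne_top n)]
  simp only [ENNReal.toReal_natCast, Real.rpow_natCast, Real.norm_eq_abs]
  gcongr

theorem summable_succ_mul_abs_of_le_rpow {f : ℕ → ℝ} {K s : ℝ} (hs : s < -2)
    (hf : ∀ j : ℕ, |f j| ≤ K * ((max j 1 : ℕ) : ℝ) ^ s) :
    Summable fun j : ℕ => ((j : ℝ) + 1) * |f j| := by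
  have hpow : Summable fun j : ℕ => ((max j 1 : ℕ) : ℝ) ^ (s + 1) := by
    rw [← summable_nat_add_iff 1]
    simpa using (summable_nat_add_iff 1).2 (Real.summable_nat_rpow.2 (by linarith : s + 1 < -1))
  refine (hpow.mul_left (2 * K)).of_nonneg_of_le (fun _ => by positivity) fun j => ?_
  have hmax : (0 : ℝ) < (max j 1 : ℕ) := by exact_mod_cast lt_max_of_lt_right one_pos
  have hj : (j : ℝ) + 1 ≤ 2 * (max j 1 : ℕ) := by exact_mod_cast (by lia : j + 1 ≤ 2 * max j 1)
  calc ((j : ℝ) + 1) * |f j| ≤ 2 * (max j 1 : ℕ) * (K * ((max j 1 : ℕ) : ℝ) ^ s) := by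
        gcongr
        exact hf j
    _ = 2 * K * ((max j 1 : ℕ) : ℝ) ^ (s + 1) := by
        rw [Real.rpow_add_one hmax.ne']
        ring

namespace ErrorModel

variable {Ω : Type*} {d q m L : ℕ}

section Signal

variable (M : ErrorModel Ω d q m L)

/-- The weights of the linear processes in `U_t^{(ν)}(s)`: the idiosyncratic noise, at index `0`,
has weight `1`, so that no case distinction between noise and factors is needed. -/
noncomputable def weight (s : Site q) (ν : Fin d) : Fin (L + 1) → ℝ :=
  Fin.cons 1 fun ℓ => M.load ν ℓ * M.prox s (M.loc ℓ)

/-- The window matrix at time `t` built from an arbitrary array `F` in place of the linear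
processes; for `F = linProc` it is `window`, see `window_eq_windowOf`. -/
noncomputable def windowOf (F : Fin (L + 1) → ℤ → Fin d → ℝ) (t : ℕ) :
    Matrix (Fin d) (Fin (m + 1)) ℝ :=
  Matrix.of fun ν k => ∑ ℓ, M.weight (M.site t k) ν ℓ * F ℓ ((t : ℤ) - ((k : ℕ) : ℤ)) ν

/-- The value of `H_ν` at the window built from the random array `F`. It gives the uncentred errors
for `F = linProc`, and their approximation by finitely many innovations for `F = truncLinProc K`. -/
noncomputable def signal (F : Fin (L + 1) → ℤ → Ω → Fin d → ℝ) (ν : Fin d) (t : ℕ) (ω : Ω) : ℝ :=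
  M.H (M.windowOf (fun ℓ τ => F ℓ τ ω) t) ν

/-- The linear processes truncated after the first `K` lags. -/
noncomputable def truncLinProc (K : ℕ) (ℓ : Fin (L + 1)) (t : ℤ) (ω : Ω) : Fin d → ℝ :=
  ∑ j ∈ Finset.range K, (M.coef ℓ j).mulVec (M.innov ℓ (t - j) ω)

/-- The size of the coefficients at lag `j`, measured entrywise in `ℓ¹`. -/
noncomputable def coefSize (j : ℕ) : ℝ≥0 :=
  ∑ ℓ, ∑ i, ∑ k, ‖M.coef ℓ j i k‖₊

/-- The information contained in the innovations at the times in `S`. -/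
abbrev innovSigma (S : Set ℤ) : MeasurableSpace Ω :=
  ⨆ i ∈ {i : Fin (L + 1) × ℤ | i.2 ∈ S}, MeasurableSpace.comap (M.innov i.1 i.2) inferInstance

theorem window_eq_windowOf (t : ℕ) (ω : Ω) :
    M.window t ω = M.windowOf (fun ℓ τ => M.linProc ℓ τ ω) t := by
  ext ν k
  simp [window, windowOf, U, weight, Fin.sum_univ_succ, add_comm]

theorem signal_truncLinProc_zero (ν : Fin d) (t : ℕ) :
    M.signal (M.truncLinProc 0) ν t = fun _ => M.H 0 ν := by
  have hwindow (ω : Ω) : M.windowOf (fun ℓ τ => M.truncLinProc 0 ℓ τ ω) t = 0 := by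
    ext ν k
    simp [windowOf, truncLinProc]
  ext ω
  rw [signal, hwindow]

theorem indepFun_innov [MeasurableSpace Ω] {μ : Measure Ω} {β : Type*} [MeasurableSpace β]
    {f : Ω → β} (hf : IndepFun f (fun ω (i : Fin (L + 1) × ℤ) => M.u i.1 i.2 ω) μ) :
    IndepFun f (fun ω (i : Fin (L + 1) × ℤ) => M.innov i.1 i.2 ω) μ :=
  hf.comp (φ := id) (ψ := fun (v : Fin (L + 1) × ℤ → Fin d → ℝ) (i : Fin (L + 1) × ℤ) =>
    (M.SigRoot i.1 i.2).mulVec (v i)) measurable_id <|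
    measurable_pi_lambda _ fun i =>
      (Continuous.matrix_mulVec continuous_const continuous_id).measurable.comp
        (measurable_pi_apply i)

theorem measurable_innov_of_mem {S : Set ℤ} {t : ℤ} (ht : t ∈ S) (ℓ : Fin (L + 1)) :
    Measurable[M.innovSigma S] (M.innov ℓ t) :=
  measurable_iff_comap_le.2 <| le_iSup₂_of_le (ℓ, t) ht le_rfl

theorem measurable_mulVec_innov {_ : MeasurableSpace Ω} {ℓ : Fin (L + 1)} {t : ℤ}
    (h : Measurable (M.innov ℓ t)) (A : Matrix (Fin d) (Fin d) ℝ) :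
    Measurable fun ω => A.mulVec (M.innov ℓ t ω) :=
  (Continuous.matrix_mulVec continuous_const continuous_id).measurable.comp h

theorem measurable_linProc {_ : MeasurableSpace Ω} {ℓ : Fin (L + 1)} {t : ℤ}
    (h : ∀ τ ≤ t, Measurable (M.innov ℓ τ)) : Measurable (M.linProc ℓ t) :=
  Measurable.tsum fun j => M.measurable_mulVec_innov (h _ (by lia)) _

theorem measurable_truncLinProc {_ : MeasurableSpace Ω} {K : ℕ} {ℓ : Fin (L + 1)} {t : ℤ}
    (h : ∀ j < K, Measurable (M.innov ℓ (t - j))) : Measurable (M.truncLinProc K ℓ t) :=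
  Finset.measurable_sum _ fun j hj => M.measurable_mulVec_innov (h j (Finset.mem_range.1 hj)) _

theorem measurable_signal {_ : MeasurableSpace Ω} {ν : Fin d} (hH : Continuous fun x => M.H x ν)
    {F : Fin (L + 1) → ℤ → Ω → Fin d → ℝ} {t : ℕ}
    (hF : ∀ ℓ, ∀ k ≤ m, Measurable (F ℓ ((t : ℤ) - (k : ℤ)))) :
    Measurable (M.signal F ν t) := by
  have hH' : Continuous fun x : Fin d → Fin (m + 1) → ℝ => M.H (Matrix.of x) ν := hH
  refine hH'.measurable.comp (measurable_pi_lambda _ fun i => measurable_pi_lambda _ fun k =>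
    Finset.measurable_sum _ fun ℓ _ => ?_)
  exact ((measurable_pi_apply i).comp (hF ℓ k (Nat.lt_succ_iff.1 k.2))).const_mul _

theorem err_eq_signal_sub [MeasurableSpace Ω] (μ : Measure Ω) (ν : Fin d) (t : ℕ) :
    M.err μ ν t =
      fun ω => M.signal M.linProc ν t ω - ∫ ω', M.signal M.linProc ν t ω' ∂μ := by
  ext ω
  simp only [err, signal, window_eq_windowOf]

theorem measurable_err {m₀ : MeasurableSpace Ω} [MeasurableSpace Ω] (μ : Measure Ω) {ν : Fin d}
    (hH : Continuous fun x => M.H x ν) {t : ℕ}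
    (h : ∀ ℓ, ∀ τ ≤ (t : ℤ), Measurable[m₀] (M.innov ℓ τ)) : Measurable[m₀] (M.err μ ν t) := by
  rw [err_eq_signal_sub]
  exact (M.measurable_signal hH fun ℓ k _ => M.measurable_linProc fun τ hτ =>
    h ℓ τ (by lia)).sub_const _

end Signal

/-- The part of the assumptions on the errors that produces short range dependence: bounded
proximity weights, independent innovations with uniformly bounded second moments, coefficients that
remain summable when weighted by the lag, and Lipschitz continuous `H_ν`. -/
structure ShortRange (M : ErrorModel Ω d q m L) [MeasurableSpace Ω] (μ : Measure Ω) : Prop where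
  prox_bounded : ∃ K : ℝ, ∀ u v, |M.prox u v| ≤ K
  measurable_innov : ∀ ℓ t, Measurable (M.innov ℓ t)
  innov_indep : iIndepFun (fun (i : Fin (L + 1) × ℤ) ω => M.innov i.1 i.2 ω) μ
  innov_moment : ∃ A : ℝ≥0, ∀ ℓ t, eLpNorm (M.innov ℓ t) 2 μ ≤ A
  summable_coef : ∀ ℓ i k, Summable fun j : ℕ => ((j : ℝ) + 1) * |M.coef ℓ j i k|
  lipschitz : ∃ LH : ℝ, ∀ ν x y, |M.H x ν - M.H y ν| ≤ LH * √(∑ i, ∑ k, (x i k - y i k) ^ 2)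

namespace ShortRange

variable [MeasurableSpace Ω] {μ : Measure Ω} {M : ErrorModel Ω d q m L}

theorem exists_abs_weight_le (hM : M.ShortRange μ) : ∃ w : ℝ, ∀ s ν ℓ, |M.weight s ν ℓ| ≤ w := by
  obtain ⟨K, hK⟩ := hM.prox_bounded
  refine ⟨1 + ∑ ν, ∑ ℓ, |M.load ν ℓ| * |K|, fun s ν => Fin.cases ?_ fun ℓ => ?_⟩
  · simpa [weight] using by positivity
  · have hℓ : |M.load ν ℓ| * |K| ≤ ∑ ν, ∑ ℓ, |M.load ν ℓ| * |K| :=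
      (Finset.single_le_sum (f := fun ℓ => |M.load ν ℓ| * |K|) (fun _ _ => by positivity)
        (Finset.mem_univ ℓ)).trans
      (Finset.single_le_sum (f := fun ν => ∑ ℓ, |M.load ν ℓ| * |K|) (fun _ _ => by positivity)
        (Finset.mem_univ ν))
    calc |M.weight s ν ℓ.succ| = |M.load ν ℓ| * |M.prox s (M.loc ℓ)| := by
          simp [weight, abs_mul]
      _ ≤ |M.load ν ℓ| * |K| :=
          mul_le_mul_of_nonneg_left ((hK _ _).trans (le_abs_self K)) (abs_nonneg _)
      _ ≤ 1 + ∑ ν, ∑ ℓ, |M.load ν ℓ| * |K| := hℓ.trans (le_add_of_nonneg_left zero_le_one)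

theorem continuous_H (hM : M.ShortRange μ) (ν : Fin d) : Continuous fun x => M.H x ν := by
  obtain ⟨LH, hLH⟩ := hM.lipschitz
  refine continuous_iff_continuousAt.2 fun y => ?_
  have hbound : Continuous fun x : Matrix (Fin d) (Fin (m + 1)) ℝ =>
      LH * √(∑ i, ∑ k, (x i k - y i k) ^ 2) := by fun_prop
  refine tendsto_iff_dist_tendsto_zero.2 <|
    squeeze_zero (fun _ => dist_nonneg) (fun x => hLH ν x y) ?_
  simpa using hbound.tendsto y

theorem exists_abs_signal_sub_le (hM : M.ShortRange μ) : ∃ c : ℝ≥0,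
    ∀ (F F' : Fin (L + 1) → ℤ → Ω → Fin d → ℝ) (ν : Fin d) (t : ℕ) (ω : Ω),
      |M.signal F ν t ω - M.signal F' ν t ω| ≤
        c * ∑ k : Fin (m + 1), ∑ ℓ, ‖F ℓ ((t : ℤ) - (k : ℕ)) ω - F' ℓ ((t : ℤ) - (k : ℕ)) ω‖ := by
  obtain ⟨w, hw⟩ := hM.exists_abs_weight_le
  obtain ⟨LH, hLH⟩ := hM.lipschitz
  refine ⟨(|LH| * (d * |w|)).toNNReal, fun F F' ν t ω => ?_⟩
  set x := M.windowOf (fun ℓ τ => F ℓ τ ω) t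
  set y := M.windowOf (fun ℓ τ => F' ℓ τ ω) t
  have hentry (i : Fin d) (k : Fin (m + 1)) : |x i k - y i k| ≤
      |w| * ∑ ℓ, ‖F ℓ ((t : ℤ) - (k : ℕ)) ω - F' ℓ ((t : ℤ) - (k : ℕ)) ω‖ := by
    simp only [x, y, windowOf, Matrix.of_apply, ← Finset.sum_sub_distrib, ← mul_sub,
      Finset.mul_sum]
    refine (Finset.abs_sum_le_sum_abs _ _).trans (Finset.sum_le_sum fun ℓ _ => ?_)
    rw [abs_mul]
    exact mul_le_mul ((hw _ _ _).trans (le_abs_self w))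
      (norm_le_pi_norm (F ℓ ((t : ℤ) - (k : ℕ)) ω - F' ℓ ((t : ℤ) - (k : ℕ)) ω) i)
      (abs_nonneg _) (abs_nonneg _)
  calc |M.signal F ν t ω - M.signal F' ν t ω| ≤ LH * √(∑ i, ∑ k, (x i k - y i k) ^ 2) :=
        hLH ν x y
    _ ≤ |LH| * ∑ i, ∑ k, |x i k - y i k| :=
        mul_le_mul (le_abs_self LH) (sqrt_sum_sum_sq_le _) (Real.sqrt_nonneg _) (abs_nonneg _)
    _ ≤ |LH| * ∑ _i : Fin d, ∑ k : Fin (m + 1),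
          |w| * ∑ ℓ, ‖F ℓ ((t : ℤ) - (k : ℕ)) ω - F' ℓ ((t : ℤ) - (k : ℕ)) ω‖ := by
        gcongr with i _ k _
        exact hentry i k
    _ = _ := by
        rw [Real.coe_toNNReal _ (by positivity), Finset.sum_const, Finset.card_univ,
          Fintype.card_fin, nsmul_eq_mul, ← Finset.mul_sum]
        ring

theorem exists_eLpNorm_signal_sub_le (hM : M.ShortRange μ) : ∃ c : ℝ≥0,
    ∀ (F F' : Fin (L + 1) → ℤ → Ω → Fin d → ℝ) (δ : ℝ≥0∞),
      (∀ ℓ τ, AEStronglyMeasurable (F ℓ τ - F' ℓ τ) μ) →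
      (∀ ℓ τ, eLpNorm (F ℓ τ - F' ℓ τ) 2 μ ≤ δ) → ∀ (ν : Fin d) (t : ℕ),
        eLpNorm (fun ω => M.signal F ν t ω - M.signal F' ν t ω) 2 μ ≤ c * δ := by
  obtain ⟨c, hc⟩ := hM.exists_abs_signal_sub_le
  refine ⟨c * ((m + 1) * (L + 1)), fun F F' δ hmeas hδ ν t => ?_⟩
  let D (k : Fin (m + 1)) (ℓ : Fin (L + 1)) : Ω → ℝ :=
    fun ω => ‖(F ℓ ((t : ℤ) - (k : ℕ)) - F' ℓ ((t : ℤ) - (k : ℕ))) ω‖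
  have hD (k ℓ) : AEStronglyMeasurable (D k ℓ) μ := (hmeas ℓ _).norm
  have hsum : eLpNorm (∑ k, ∑ ℓ, D k ℓ) 2 μ ≤ ∑ _k : Fin (m + 1), ∑ _ℓ : Fin (L + 1), δ :=
    (eLpNorm_sum_le (fun k _ => Finset.aestronglyMeasurable_sum _ fun ℓ _ => hD k ℓ)
      one_le_two).trans <| Finset.sum_le_sum fun k _ =>
    (eLpNorm_sum_le (fun ℓ _ => hD k ℓ) one_le_two).trans <| Finset.sum_le_sum fun ℓ _ =>
    (eLpNorm_norm _).trans_le (hδ ℓ _)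
  calc eLpNorm (fun ω => M.signal F ν t ω - M.signal F' ν t ω) 2 μ
      ≤ c • eLpNorm (∑ k, ∑ ℓ, D k ℓ) 2 μ :=
        eLpNorm_le_nnreal_smul_eLpNorm_of_ae_le_mul (ae_of_all _ fun ω => by
          simpa [D, ← NNReal.coe_le_coe] using
            (hc F F' ν t ω).trans (mul_le_mul_of_nonneg_left (le_abs_self _) c.2)) 2
    _ ≤ c • ∑ _k : Fin (m + 1), ∑ _ℓ : Fin (L + 1), δ := by gcongr
    _ = _ := by
        simp [ENNReal.smul_def, mul_assoc]

theorem tsum_tsum_coefSize_ne_top (hM : M.ShortRange μ) :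
    ∑' K, ∑' j, (M.coefSize (j + K) : ℝ≥0∞) ≠ ∞ := by
  have hentry (ℓ i k) : ∑' n : ℕ, (n + 1) * ‖M.coef ℓ n i k‖ₑ ≠ ∞ := by
    refine ne_of_eq_of_ne (tsum_congr fun n => ?_) (hM.summable_coef ℓ i k).tsum_ofReal_ne_top
    rw [ENNReal.ofReal_mul (by positivity), Real.enorm_eq_ofReal_abs]
    norm_cast
  rw [tsum_tsum_nat_add_eq fun j => (M.coefSize j : ℝ≥0∞)]
  simp only [coefSize, ENNReal.ofNNReal_finsetSum, Finset.mul_sum,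
    Summable.tsum_finsetSum fun _ _ => ENNReal.summable]
  exact ENNReal.sum_ne_top.2 fun ℓ _ => ENNReal.sum_ne_top.2 fun i _ =>
    ENNReal.sum_ne_top.2 fun k _ => hentry ℓ i k

theorem exists_eLpNorm_linProc_sub_truncLinProc_le (hM : M.ShortRange μ) : ∃ A : ℝ≥0,
    ∀ ℓ t K, eLpNorm (M.linProc ℓ t - M.truncLinProc K ℓ t) 2 μ ≤
      A * ∑' j, (M.coefSize (j + K) : ℝ≥0∞) := by
  obtain ⟨A, hA⟩ := hM.innov_moment
  refine ⟨A, fun ℓ t K => ?_⟩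
  let lagTerm (j : ℕ) (ω : Ω) : Fin d → ℝ := (M.coef ℓ j).mulVec (M.innov ℓ (t - j) ω)
  have hmeas (j : ℕ) : AEStronglyMeasurable (lagTerm j) μ :=
    (M.measurable_mulVec_innov (hM.measurable_innov ℓ _) _).aestronglyMeasurable
  have hcoef (j : ℕ) : ∑ i, ∑ k, ‖M.coef ℓ j i k‖₊ ≤ M.coefSize j :=
    Finset.single_le_sum (f := fun ℓ => ∑ i, ∑ k, ‖M.coef ℓ j i k‖₊) (fun _ _ => zero_le)
      (Finset.mem_univ ℓ)
  have hterm (j : ℕ) : eLpNorm (lagTerm j) 2 μ ≤ A * (M.coefSize j : ℝ≥0∞) :=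
    calc eLpNorm (lagTerm j) 2 μ ≤ M.coefSize j • eLpNorm (M.innov ℓ (t - j)) 2 μ :=
          eLpNorm_le_nnreal_smul_eLpNorm_of_ae_le_mul (ae_of_all _ fun ω =>
            (nnnorm_mulVec_le (M.coef ℓ j) _).trans (mul_le_mul_left (hcoef j) _)) 2
      _ ≤ A * (M.coefSize j : ℝ≥0∞) := by
          rw [ENNReal.smul_def, smul_eq_mul, mul_comm]
          exact mul_le_mul_left (hA ℓ _) _
  have hsum : ∑' j, eLpNorm (lagTerm j) 2 μ ≠ ∞ := by
    refine ne_top_of_le_ne_top ?_ (ENNReal.tsum_le_tsum hterm)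
    rw [ENNReal.tsum_mul_left]
    exact ENNReal.mul_ne_top ENNReal.coe_ne_top
      (ENNReal.ne_top_of_tsum_ne_top hM.tsum_tsum_coefSize_ne_top 0)
  rw [← ENNReal.tsum_mul_left]
  exact (eLpNorm_tsum_sub_sum_range_le one_le_two hmeas hsum K).trans
    (ENNReal.tsum_le_tsum fun j => hterm (j + K))

theorem exists_eLpNorm_signal_linProc_sub_truncLinProc_le (hM : M.ShortRange μ) :
    ∃ δ : ℕ → ℝ≥0∞, ∑' K, δ K ≠ ∞ ∧ ∀ ν t K, eLpNorm (fun ω =>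
      M.signal M.linProc ν t ω - M.signal (M.truncLinProc K) ν t ω) 2 μ ≤ δ K := by
  obtain ⟨c, hc⟩ := hM.exists_eLpNorm_signal_sub_le
  obtain ⟨A, hA⟩ := hM.exists_eLpNorm_linProc_sub_truncLinProc_le
  refine ⟨fun K => c * (A * ∑' j, (M.coefSize (j + K) : ℝ≥0∞)), ?_, fun ν t K =>
    hc _ _ _ (fun ℓ τ => ?_) (fun ℓ τ => hA ℓ τ K) ν t⟩
  · simp only [ENNReal.tsum_mul_left]
    exact ENNReal.mul_ne_top ENNReal.coe_ne_top
      (ENNReal.mul_ne_top ENNReal.coe_ne_top hM.tsum_tsum_coefSize_ne_top)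
  · exact ((M.measurable_linProc fun τ _ => hM.measurable_innov ℓ τ).sub
      (M.measurable_truncLinProc fun j _ => hM.measurable_innov ℓ _)).aestronglyMeasurable

theorem measurable_signal_linProc (hM : M.ShortRange μ) (ν : Fin d) (t : ℕ) :
    Measurable (M.signal M.linProc ν t) :=
  M.measurable_signal (hM.continuous_H ν) fun ℓ _ _ =>
    M.measurable_linProc fun τ _ => hM.measurable_innov ℓ τ

theorem measurable_signal_truncLinProc (hM : M.ShortRange μ) (ν : Fin d) (t K : ℕ) :
    Measurable (M.signal (M.truncLinProc K) ν t) :=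
  M.measurable_signal (hM.continuous_H ν) fun ℓ _ _ =>
    M.measurable_truncLinProc fun _ _ => hM.measurable_innov ℓ _

theorem memLp_signal_linProc [IsProbabilityMeasure μ] (hM : M.ShortRange μ) (ν : Fin d) (t : ℕ) :
    MemLp (M.signal M.linProc ν t) 2 μ := by
  obtain ⟨δ, hδ, hle⟩ := hM.exists_eLpNorm_signal_linProc_sub_truncLinProc_le
  have hdiff : MemLp (fun ω => M.signal M.linProc ν t ω - M.H 0 ν) 2 μ := by
    refine ⟨((hM.measurable_signal_linProc ν t).sub_const _).aestronglyMeasurable, ?_⟩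
    have h := hle ν t 0
    rw [signal_truncLinProc_zero] at h
    exact h.trans_lt (ENNReal.ne_top_of_tsum_ne_top hδ 0).lt_top
  simpa only [Pi.add_def, sub_add_cancel] using hdiff.add (memLp_const (M.H 0 ν))

theorem memLp_signal_truncLinProc [IsProbabilityMeasure μ] (hM : M.ShortRange μ) (ν : Fin d)
    (t K : ℕ) : MemLp (M.signal (M.truncLinProc K) ν t) 2 μ := by
  obtain ⟨δ, hδ, hle⟩ := hM.exists_eLpNorm_signal_linProc_sub_truncLinProc_le
  have hdiff : MemLp (fun ω =>
      M.signal M.linProc ν t ω - M.signal (M.truncLinProc K) ν t ω) 2 μ :=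
    ⟨((hM.measurable_signal_linProc ν t).sub
      (hM.measurable_signal_truncLinProc ν t K)).aestronglyMeasurable,
      (hle ν t K).trans_lt (ENNReal.ne_top_of_tsum_ne_top hδ K).lt_top⟩
  simpa only [Pi.sub_def, sub_sub_cancel] using (hM.memLp_signal_linProc ν t).sub hdiff

theorem measurable_err (hM : M.ShortRange μ) (ν : Fin d) (t : ℕ) : Measurable (M.err μ ν t) :=
  M.measurable_err μ (hM.continuous_H ν) fun ℓ τ _ => hM.measurable_innov ℓ τ

theorem memLp_err [IsProbabilityMeasure μ] (hM : M.ShortRange μ) (ν : Fin d) (t : ℕ) :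
    MemLp (M.err μ ν t) 2 μ := by
  rw [err_eq_signal_sub]
  exact (hM.memLp_signal_linProc ν t).sub (memLp_const _)

theorem integral_err_eq_zero [IsProbabilityMeasure μ] (hM : M.ShortRange μ) (ν : Fin d) (t : ℕ) :
    ∫ ω, M.err μ ν t ω ∂μ = 0 := by
  rw [err_eq_signal_sub,
    integral_sub ((hM.memLp_signal_linProc ν t).integrable one_le_two) (integrable_const _)]
  simp

theorem indep_innovSigma (hM : M.ShortRange μ) {S S' : Set ℤ} (hSS' : Disjoint S S') :
    Indep (M.innovSigma S) (M.innovSigma S') μ :=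
  indep_iSup_of_disjoint
    (m := fun i : Fin (L + 1) × ℤ => MeasurableSpace.comap (M.innov i.1 i.2) inferInstance)
    (fun i => (hM.measurable_innov i.1 i.2).comap_le)
    hM.innov_indep (Set.disjoint_left.2 fun _ h h' => Set.disjoint_left.1 hSS' h h')

theorem measurable_innovSigma_err (hM : M.ShortRange μ) (ν : Fin d) (t : ℕ) :
    Measurable[M.innovSigma (Set.Iic t)] (M.err μ ν t) :=
  M.measurable_err μ (hM.continuous_H ν) fun ℓ _ hτ =>
    M.measurable_innov_of_mem (Set.mem_Iic.2 hτ) ℓ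

/-- Truncating at lag `t - s - m` leaves only innovations after time `s` in the window at time
`t`; if `t ≤ s + m`, it leaves none. -/
theorem indepFun_err_signal_truncLinProc (hM : M.ShortRange μ) (ν : Fin d) (s t : ℕ) :
    IndepFun (M.err μ ν s) (M.signal (M.truncLinProc (t - s - m)) ν t) μ := by
  have hsignal : Measurable[M.innovSigma (Set.Ioi s)]
      (M.signal (M.truncLinProc (t - s - m)) ν t) :=
    M.measurable_signal (hM.continuous_H ν) fun ℓ k hk => M.measurable_truncLinProc fun j hj =>
      M.measurable_innov_of_mem (Set.mem_Ioi.2 (by lia)) ℓ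
  rw [IndepFun_iff_Indep]
  exact indep_of_indep_of_le_left (indep_of_indep_of_le_right
    (hM.indep_innovSigma (Set.Iic_disjoint_Ioi le_rfl))
    hsignal.comap_le) (hM.measurable_innovSigma_err ν s).comap_le

theorem exists_enorm_integral_err_mul_err_le [IsProbabilityMeasure μ] (hM : M.ShortRange μ) :
    ∃ ρ : ℕ → ℝ≥0∞, ∑' n, ρ n ≠ ∞ ∧
      ∀ ν s t, ‖∫ ω, M.err μ ν s ω * M.err μ ν t ω ∂μ‖ₑ ≤ ρ (t - s) := by
  obtain ⟨δ, hδ, hle⟩ := hM.exists_eLpNorm_signal_linProc_sub_truncLinProc_le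
  have herr (ν s) : eLpNorm (M.err μ ν s) 2 μ ≤ 2 * δ 0 := by
    let f (ω : Ω) : ℝ := M.signal M.linProc ν s ω - M.H 0 ν
    have hcentre : M.err μ ν s = fun ω => f ω - ∫ ω', f ω' ∂μ := by
      ext ω
      rw [err_eq_signal_sub, integral_sub ((hM.memLp_signal_linProc ν s).integrable one_le_two)
        (integrable_const _)]
      simp [f]
    have hf : eLpNorm f 2 μ ≤ δ 0 := by simpa only [signal_truncLinProc_zero] using hle ν s 0
    rw [hcentre]
    exact (eLpNorm_sub_integral_le one_le_two
      ((hM.measurable_signal_linProc ν s).sub_const _).aestronglyMeasurable).trans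
      (mul_le_mul_right hf 2)
  refine ⟨fun n => 2 * δ 0 * δ (n - m), ?_, fun ν s t => ?_⟩
  · rw [ENNReal.tsum_mul_left]
    exact ENNReal.mul_ne_top
      (ENNReal.mul_ne_top ENNReal.ofNat_ne_top (ENNReal.ne_top_of_tsum_ne_top hδ 0))
      (tsum_comp_tsub_ne_top hδ m)
  · rw [M.err_eq_signal_sub μ ν t]
    exact (enorm_integral_mul_sub_const_le_of_indepFun (hM.memLp_err ν s)
      (hM.integral_err_eq_zero ν s) (hM.memLp_signal_linProc ν t)
      (hM.memLp_signal_truncLinProc ν t _) (hM.indepFun_err_signal_truncLinProc ν s t) _).trans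
      (mul_le_mul' (herr ν s) (hle ν t _))

theorem exists_sum_abs_integral_err_mul_err_le [IsProbabilityMeasure μ] (hM : M.ShortRange μ) :
    ∃ Q : ℝ, ∀ ν s (I : Finset ℕ), ∑ t ∈ I, |∫ ω, M.err μ ν s ω * M.err μ ν t ω ∂μ| ≤ Q := by
  obtain ⟨ρ, hρ, hle⟩ := hM.exists_enorm_integral_err_mul_err_le
  exact ⟨_, fun ν s I => sum_abs_le_two_mul_toReal_tsum
    (fun s t => by simp only [mul_comm]) hρ (fun s t _ => hle ν s t) s I⟩

theorem indepFun_err (hM : M.ShortRange μ) {β : Type*} [MeasurableSpace β] {f : Ω → β}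
    (hf : IndepFun f (fun ω (i : Fin (L + 1) × ℤ) => M.innov i.1 i.2 ω) μ) (ν : Fin d) :
    IndepFun f (fun ω t => M.err μ ν t ω) μ := by
  have herr : Measurable[MeasurableSpace.comap
      (fun ω (i : Fin (L + 1) × ℤ) => M.innov i.1 i.2 ω) inferInstance]
      fun ω t => M.err μ ν t ω :=
    @measurable_pi_lambda _ _ _ (_) _ _ fun t =>
      M.measurable_err μ (hM.continuous_H ν) fun ℓ τ _ =>
        (measurable_pi_apply (ℓ, τ)).comp
          (comap_measurable fun ω (i : Fin (L + 1) × ℤ) => M.innov i.1 i.2 ω)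
  rw [IndepFun_iff_Indep] at hf ⊢
  exact indep_of_indep_of_le_right hf herr.comap_le

theorem exists_growthOfSumMoment [IsProbabilityMeasure μ] (hM : M.ShortRange μ) (B : ℝ) :
    ∃ Cν : ℝ, ∀ (ν : Fin d) (T₀ : ℕ) (p : ℕ → ℕ) (X : ℕ → ℕ → ℕ → Ω → ℝ),
      (∀ T t j, Measurable (X T t j)) →
      (∀ T ≥ T₀, ∀ t ≥ 1, ∀ j < p T, ∀ᵐ ω ∂μ, |X T t j ω| ≤ B) →
      (∀ T ≥ T₀, ∀ j < p T, IndepFun (fun ω t => X T (t + 1) j ω)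
        (fun ω (i : Fin (L + 1) × ℤ) => M.innov i.1 i.2 ω) μ) →
      GrowthOfSumMoment μ T₀ p X (M.err μ ν) 2 Cν := by
  obtain ⟨Q, hQ⟩ := hM.exists_sum_abs_integral_err_mul_err_le
  refine ⟨B ^ 2 * Q, fun ν T₀ p X hX hB hind γ h2 hγ T hT N j hj => ?_⟩
  obtain rfl : γ = 2 := le_antisymm hγ h2
  have hx : ∀ t ∈ Finset.range N, AEStronglyMeasurable (X T (t + 1) j) μ :=
    fun t _ => (hX T (t + 1) j).aestronglyMeasurable
  have hxB : ∀ t ∈ Finset.range N, ∀ᵐ ω ∂μ, |X T (t + 1) j ω| ≤ B :=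
    fun t _ => hB T hT (t + 1) (Nat.le_add_left 1 t) j hj
  have he : ∀ t ∈ Finset.range N, MemLp (M.err μ ν (t + 1)) 2 μ :=
    fun t _ => hM.memLp_err ν (t + 1)
  have hind' : IndepFun (fun ω t => X T (t + 1) j ω) (fun ω t => M.err μ ν (t + 1) ω) μ :=
    (hM.indepFun_err (hind T hT j hj) ν).comp (φ := id)
      (ψ := fun (v : ℕ → ℝ) t => v (t + 1)) measurable_id (by fun_prop)
  have hshift (f : ℕ → ℝ) : ∑ t ∈ Finset.Icc 1 N, f t = ∑ t ∈ Finset.range N, f (t + 1) := by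
    rw [Finset.range_eq_Ico, Finset.sum_Ico_add', zero_add, Finset.Ico_add_one_right_eq_Icc]
  have hbound := integral_sum_mul_sq_le hx hxB he hind' fun s _ =>
    (hshift fun t => |∫ ω, M.err μ ν (s + 1) ω * M.err μ ν t ω ∂μ|).symm.trans_le (hQ ν (s + 1) _)
  simpa only [hshift, Real.rpow_two, sq_abs, div_self (two_ne_zero' ℝ), Real.rpow_one,
    Finset.card_range] using
    And.intro (memLp_sum_mul_of_bounded hx hxB he).integrable_sq hbound

end ShortRange

namespace Assumptions

variable [MeasurableSpace Ω] {μ : Measure Ω} {M : ErrorModel Ω d q m L}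

theorem measurable_innov (hM : M.Assumptions μ) (ℓ : Fin (L + 1)) (t : ℤ) :
    Measurable (M.innov ℓ t) :=
  (Continuous.matrix_mulVec continuous_const continuous_id).measurable.comp (hM.u_measurable ℓ t)

theorem exists_eLpNorm_innov_le [IsProbabilityMeasure μ] (hM : M.Assumptions μ) :
    ∃ A : ℝ≥0, ∀ ℓ t, eLpNorm (M.innov ℓ t) 2 μ ≤ A := by
  obtain ⟨K, hK⟩ := hM.innov_moment
  refine ⟨d * (K ^ (4⁻¹ : ℝ)).toNNReal, fun ℓ t => ?_⟩
  have hcoord (i : Fin d) : AEStronglyMeasurable (fun ω => M.innov ℓ t ω i) μ :=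
    ((measurable_pi_apply i).comp (hM.measurable_innov ℓ t)).aestronglyMeasurable
  calc eLpNorm (M.innov ℓ t) 2 μ ≤ ∑ i, eLpNorm (fun ω => M.innov ℓ t ω i) 2 μ :=
        eLpNorm_pi_le_sum (hM.measurable_innov ℓ t).aestronglyMeasurable one_le_two
    _ ≤ ∑ i, eLpNorm (fun ω => M.innov ℓ t ω i) (4 : ℕ) μ :=
        Finset.sum_le_sum fun i _ =>
          eLpNorm_le_eLpNorm_of_exponent_le (by norm_num) (hcoord i)
    _ ≤ ∑ _i : Fin d, ENNReal.ofReal (K ^ (4⁻¹ : ℝ)) :=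
        Finset.sum_le_sum fun i _ => by
          simpa using eLpNorm_le_of_integral_abs_pow_le (hcoord i) four_ne_zero (hK ℓ t i).1
            (hK ℓ t i).2
    _ = _ := by simp [ENNReal.ofReal]

theorem shortRange [IsProbabilityMeasure μ] (hM : M.Assumptions μ) : M.ShortRange μ where
  prox_bounded := ⟨1, fun u v => abs_le.2 ⟨by linarith [(hM.prox_mem u v).1], (hM.prox_mem u v).2⟩⟩
  measurable_innov := hM.measurable_innov
  innov_indep := hM.innov_indep
  innov_moment := hM.exists_eLpNorm_innov_le
  summable_coef ℓ i k := by
    obtain ⟨K, δ', hδ', hdecay⟩ := hM.decay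
    exact summable_succ_mul_abs_of_le_rpow (by linarith) fun j => hdecay ℓ j i k
  lipschitz := hM.lipschitz

end Assumptions

end ErrorModel

theorem measurable_netOutput {Ω : Type*} [MeasurableSpace Ω] {g : ℕ → ℕ → ℝ → ℝ}
    (hg : ∀ k j, Measurable (g k j)) (n : ℕ → ℕ) {W : ℕ → ℕ → ℕ → Ω → ℝ} {b : ℕ → ℕ → Ω → ℝ}
    {z : ℕ → Ω → ℝ} (hW : ∀ k j i, Measurable (W k j i)) (hb : ∀ k j, Measurable (b k j))
    (hz : ∀ i, Measurable (z i)) (k j : ℕ) :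
    Measurable fun ω => netOutput g n (fun k j i => W k j i ω) (fun k j => b k j ω)
      (fun i => z i ω) k j := by
  induction k generalizing j with
  | zero => exact hz j
  | succ k ih =>
    exact (hg _ _).comp ((hb _ _).add (Finset.measurable_sum _ fun i _ => (hW _ _ _).mul (ih i)))

theorem indepFun_netOutput {Ω β : Type*} [MeasurableSpace Ω] [MeasurableSpace β] {μ : Measure Ω}
    {g : ℕ → ℕ → ℝ → ℝ} (hg : ∀ k j, Measurable (g k j)) (n : ℕ → ℕ) {W : ℕ → ℕ → ℕ → Ω → ℝ}
    {b : ℕ → ℕ → Ω → ℝ} {z : ℕ → ℕ → Ω → ℝ} {f : Ω → β}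
    (hf : IndepFun (fun ω => ((fun i : ℕ × ℕ × ℕ => W i.1 i.2.1 i.2.2 ω),
      (fun i : ℕ × ℕ => b i.1 i.2 ω), (fun i : ℕ × ℕ => z i.1 i.2 ω))) f μ) (k j : ℕ) :
    IndepFun (fun ω t => netOutput g n (fun k j i => W k j i ω) (fun k j => b k j ω)
      (fun i => z t i ω) k j) f μ := by
  let features (w : (ℕ × ℕ × ℕ → ℝ) × (ℕ × ℕ → ℝ) × (ℕ × ℕ → ℝ)) (t : ℕ) : ℝ :=
    netOutput g n (fun k j i => w.1 (k, j, i)) (fun k j => w.2.1 (k, j)) (fun i => w.2.2 (t, i)) k j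
  have hfeatures : Measurable features := measurable_pi_lambda _ fun t =>
    measurable_netOutput hg n (by fun_prop) (by fun_prop) (by fun_prop) k j
  exact hf.comp (ψ := id) hfeatures measurable_id

theorem mainTheorem1_general {Ω : Type*} [MeasurableSpace Ω] (μ : Measure Ω)
    [IsProbabilityMeasure μ] {T₀ : ℕ} (hT₀ : 1 ≤ T₀) {p : ℕ → ℕ} {X : ℕ → ℕ → ℕ → Ω → ℝ}
    (hX : ∀ T t j, Measurable (X T t j)) {B a : ℝ}
    (hB : ∀ T ≥ T₀, ∀ t ≥ 1, ∀ j < p T, ∀ᵐ ω ∂μ, |X T t j ω| ≤ B) (ha : 0 < a)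
    (hspec : ∀ T ≥ T₀, ∀ᵐ ω ∂μ, spectrum ℝ (gramMatrix p X T ω) ⊆ Set.Ici a) (η : ℝ) :
    (RateCondition T₀ p η → ∀ γ' : ℝ, 2 ≤ γ' → ∃ K > (0 : ℝ), ∃ C' > (0 : ℝ),
      ∀ (e : ℕ → Ω → ℝ), (∀ t, AEMeasurable (e t) μ) → ∀ Cν : ℝ,
        GrowthOfSumMoment μ T₀ p X e γ' Cν →
        ConsistencyAssertions μ T₀ p X η e γ' Cν K C') ∧
    ∀ (d q m L : ℕ) (M : ErrorModel Ω d q m L), M.ShortRange μ →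
      (∀ T ≥ T₀, ∀ j < p T, IndepFun (fun ω t => X T (t + 1) j ω)
        (fun ω (i : Fin (L + 1) × ℤ) => M.innov i.1 i.2 ω) μ) →
      ∃ Cν : ℝ, ∀ ν : Fin d,
        GrowthOfSumMoment μ T₀ p X (M.err μ ν) 2 Cν ∧
        (∀ᵐ ω₀ ∂μ, GrowthOfSumMoment μ T₀ p (fun T t j _ => X T t j ω₀) (M.err μ ν) 2 Cν) ∧
        (RateCondition T₀ p η → ∃ K > (0 : ℝ), ∃ C' > (0 : ℝ),
          ConsistencyAssertions μ T₀ p X η (M.err μ ν) 2 Cν K C' ∧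
          ∀ᵐ ω₀ ∂μ, ConsistencyAssertions μ T₀ p (fun T t j _ => X T t j ω₀) η
            (M.err μ ν) 2 Cν K C') := by
  refine ⟨fun hrate γ' hγ' => ⟨max 1 a⁻¹ ^ γ', by positivity, 1, one_pos, fun e he Cν hG =>
    consistencyAssertions_of_growthOfSumMoment hX ha hspec hγ' he hG hT₀ hrate⟩,
    fun d q m L M hM hind => ?_⟩
  obtain ⟨Cν, hCν⟩ := hM.exists_growthOfSumMoment B
  have hfrozen : ∀ᵐ ω₀ ∂μ, (∀ T ≥ T₀, ∀ t ≥ 1, ∀ j < p T, |X T t j ω₀| ≤ B) ∧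
      ∀ T ≥ T₀, spectrum ℝ (gramMatrix p X T ω₀) ⊆ Set.Ici a := by
    simpa only [eventually_and, ae_all_iff] using And.intro hB hspec
  have herr (ν : Fin d) (t : ℕ) := (hM.measurable_err ν t).aemeasurable (μ := μ)
  refine ⟨Cν, fun ν => ?_⟩
  have hG := hCν ν T₀ p X hX hB hind
  have hG₀ : ∀ᵐ ω₀ ∂μ, GrowthOfSumMoment μ T₀ p (fun T t j _ => X T t j ω₀) (M.err μ ν) 2 Cν :=
    hfrozen.mono fun ω₀ h => hCν ν T₀ p _ (fun _ _ _ => measurable_const)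
      (fun T hT t ht j hj => ae_of_all _ fun _ => h.1 T hT t ht j hj)
      fun _ _ _ _ => indepFun_const_left _ _
  refine ⟨hG, hG₀, fun hrate => ⟨max 1 a⁻¹ ^ (2 : ℝ), by positivity, 1, one_pos, ?_, ?_⟩⟩
  · exact consistencyAssertions_of_growthOfSumMoment hX ha hspec le_rfl (herr ν) hG hT₀ hrate
  · filter_upwards [hfrozen, hG₀] with ω₀ h hG₀
    exact consistencyAssertions_of_growthOfSumMoment (X := fun T t j _ => X T t j ω₀)
      (fun _ _ _ => measurable_const) ha (fun T hT => ae_of_all _ fun _ => h.2 T hT) le_rfl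
      (herr ν) hG₀ hT₀ hrate

theorem mainTheorem1 {Ω : Type*} [MeasurableSpace Ω] (μ : Measure Ω) [IsProbabilityMeasure μ]
    (T₀ : ℕ) (hT₀ : 1 ≤ T₀) (p : ℕ → ℕ)
    (X : ℕ → ℕ → ℕ → Ω → ℝ) (hX : ∀ T t j, Measurable (X T t j))
    (Sx : ∀ T, Matrix (Fin (p T)) (Fin (p T)) ℝ) (B η C a b : ℝ)
    (hreg : RegressorAssumption μ T₀ p X Sx B η C a b) :
    -- (i) consistency under the growth of sum moment assumption
    (RateCondition T₀ p η → ∀ γ' : ℝ, 2 ≤ γ' → ∃ K > (0 : ℝ), ∃ C' > (0 : ℝ),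
      ∀ (e : ℕ → Ω → ℝ), (∀ t, AEMeasurable (e t) μ) → ∀ Cν : ℝ,
        GrowthOfSumMoment μ T₀ p X e γ' Cν →
        ConsistencyAssertions μ T₀ p X η e γ' Cν K C') ∧
    -- (ii) the error model, with regressors independent of the errors (for example non-random)
    (∀ (d q m L : ℕ) (M : ErrorModel Ω d q m L), M.Assumptions μ →
      (∀ T, IndepFun (fun ω (i : ℕ × ℕ) => X T i.1 i.2 ω)
        (fun ω (i : Fin (L + 1) × ℤ) => M.u i.1 i.2 ω) μ) →
      ∀ ν : Fin d, ∃ Cν : ℝ,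
        GrowthOfSumMoment μ T₀ p X (M.err μ ν) 2 Cν ∧
        (RateCondition T₀ p η → ∃ K > (0 : ℝ), ∃ C' > (0 : ℝ),
          ConsistencyAssertions μ T₀ p X η (M.err μ ν) 2 Cν K C')) ∧
    -- (iii) features of a network with `r` hidden layers, random weights and random inputs: the
    -- assertions hold jointly, and conditionally on the weights and inputs (frozen features)
    (∀ (d q m L : ℕ) (M : ErrorModel Ω d q m L), M.Assumptions μ →
      ∀ (r : ℕ), 1 ≤ r → ∀ (g : ℕ → ℕ → ℝ → ℝ), (∀ k j, Measurable (g k j)) →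
      ∀ (n : ℕ → ℕ → ℕ), (∀ T, n T r = p T) →
      ∀ (W : ℕ → ℕ → ℕ → ℕ → Ω → ℝ) (bias : ℕ → ℕ → ℕ → Ω → ℝ) (z : ℕ → ℕ → Ω → ℝ),
      (∀ T k j i, Measurable (W T k j i)) → (∀ T k j, Measurable (bias T k j)) →
      (∀ t i, Measurable (z t i)) →
      (∀ T, IndepFun
        (fun ω => ((fun i : ℕ × ℕ × ℕ => W T i.1 i.2.1 i.2.2 ω),
          (fun i : ℕ × ℕ => bias T i.1 i.2 ω), (fun i : ℕ × ℕ => z i.1 i.2 ω)))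
        (fun ω (i : Fin (L + 1) × ℤ) => M.u i.1 i.2 ω) μ) →
      (∀ T ≥ T₀, ∀ t ≥ 1, ∀ j < p T, ∀ ω, X T t j ω =
        netOutput g (n T) (fun k j i => W T k j i ω) (fun k j => bias T k j ω)
          (fun i => z t i ω) r j) →
      ∀ ν : Fin d, ∃ Cν : ℝ,
        GrowthOfSumMoment μ T₀ p X (M.err μ ν) 2 Cν ∧
        (∀ᵐ ω₀ ∂μ, GrowthOfSumMoment μ T₀ p (fun T t j _ => X T t j ω₀) (M.err μ ν) 2 Cν) ∧
        (RateCondition T₀ p η → ∃ K > (0 : ℝ), ∃ C' > (0 : ℝ),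
          ConsistencyAssertions μ T₀ p X η (M.err μ ν) 2 Cν K C' ∧
          ∀ᵐ ω₀ ∂μ, ConsistencyAssertions μ T₀ p (fun T t j _ => X T t j ω₀) η
            (M.err μ ν) 2 Cν K C')) := by
  have hspec (T : ℕ) (hT : T ≥ T₀) :=
    (hreg.spec T hT).mono fun _ h => h.trans Set.Icc_subset_Ici_self
  obtain ⟨hi, hii⟩ := mainTheorem1_general μ hT₀ hX hreg.bounded hreg.a_pos hspec η
  refine ⟨hi, fun d q m L M hM hind ν => ?_,
    fun d q m L M hM r _ g hg n _ W bias z _ _ _ hind hnet ν => ?_⟩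
  · have hcol (T : ℕ) (j : ℕ) := M.indepFun_innov <| (hind T).comp
      (φ := fun (v : ℕ × ℕ → ℝ) t => v (t + 1, j)) (ψ := id) (by fun_prop) measurable_id
    obtain ⟨Cν, hCν⟩ := hii d q m L M hM.shortRange fun T _ j _ => hcol T j
    obtain ⟨hG, -, hcons⟩ := hCν ν
    exact ⟨Cν, hG, fun hrate =>
      let ⟨K, hK, C', hC', h, _⟩ := hcons hrate
      ⟨K, hK, C', hC', h⟩⟩
  · have hcol (T : ℕ) (hT : T ≥ T₀) (j : ℕ) (hj : j < p T) :
        IndepFun (fun ω t => X T (t + 1) j ω)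
          (fun ω (i : Fin (L + 1) × ℤ) => M.innov i.1 i.2 ω) μ := by
      simp only [hnet T hT _ (Nat.le_add_left 1 _) j hj]
      exact M.indepFun_innov <| (indepFun_netOutput hg (n T) (hind T) r j).comp
        (φ := fun (v : ℕ → ℝ) t => v (t + 1)) (ψ := id) (by fun_prop) measurable_id
    obtain ⟨Cν, hCν⟩ := hii d q m L M hM.shortRange hcol
    exact ⟨Cν, hCν ν⟩
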